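/- Let $\Omega$ be a finite non-empty set of size $A$, $H:\Omega\to\{0,\dots,n\}$, and for $\beta\in[0,\infty]$ let $$Z(\beta)=\sum_{x\in\Omega}e^{-\beta H(x)},\qquad \pi_\beta(x)=\frac{e^{-\beta H(x)}}{Z(\beta)},$$ where $e^{-\infty\cdot 0}=1$ and $e^{-\infty\cdot h}=0$ for $h>0$; thus $Z(0)=A$ and $Z(\infty)=|\{x:H(x)=0\}|$. A sequence $0=\beta_0<\beta_1<\dots<\beta_\ell=\infty$ is a $B$-Chebyshev cooling schedule for $Z$ if $Z(\infty)\neq 0$ and $$\frac{Z(2\beta_{i+1}-\beta_i)\,Z(\beta_i)}{Z(\beta_{i+1})^2}\le B\qquad\text{for all } 0\le i<\ell .$$ (This forces $B\ge 1$.) An exact sampler for $\pi_i:=\pi_{\beta_i}$ consists of a unitary $U_i$ on a finite-dimensional register with a fixed initial basis state $|s_0\rangle$ and a map $\varphi_i$ from basis labels to $\Omega$, such that measuring $U_i|s_0\rangle$ in the computational basis with outcome $s$ and outputting $\varphi_i(s)$ gives $x$ with probability exactly $\pi_i(x)$, for every $x\in\Omega$. A quantum algorithm with access to $H$ and to such samplers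 works on these registers and a finite-dimensional workspace; it applies unitary gates, makes computational-basis measurements and branches on their outcomes, and outputs a real number. It uses the $U_i$, their inverses, and the map $|x\rangle|j\rangle\mapsto|x\rangle|j+H(x)\bmod (n+1)\rangle$ and its inverse as black boxes only. Each use of some $U_i$ or $U_i^{-1}$ counts as one sample. **Theorem.** There is a universal constant $C>0$ with the following property. Let $\Omega$, $n$, $\ell$, $0=\beta_0<\dots<\beta_\ell=\infty$, $B\ge 1$, $\varepsilon>0$, a register, $s_0$ and $\varphi_1,\dots,\varphi_{\ell-1}$ be given. There is a quantum algorithm, depending only on these data, such that for every $H:\Omega\to\{0,\dots,n\}$ for which $(\beta_i)$ is a $B$-Chebyshev cooling schedule, and for all unitaries $U_1,\dots,U_{\ell-1}$ that, with $s_0$ and the $\varphi_i$, are exact samplers for $\pi_1,\dots,\pi_{\ell-1}$, its output $\widetilde Z$ satisfies $$\Pr\bigl[(1-\varepsilon)Z(\infty)\le\widetilde Z\le(1+\varepsilon)Z(\infty)\bigr]\ge \tfrac34 .$$ In the worst case the algorithm uses at most $$C\cdot\frac{B\,\ell^2\,L(\ell)}{\varepsilon}\;L\!\left(\frac{B\ell}{\varepsilon}\right)^{3/2}L\!\left(L\!\left(\frac{B\ell}{\varepsilon}\right)\right)=\widetilde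 O\!\left(\frac{B\ell^2}{\varepsilon}\right)$$ samples in total, and it evaluates $H$ at most that many times, where $L(x)=\max\{1,\log x\}$. -/

import Mathlib

open scoped ENNReal

noncomputable section

/-! ### Partition functions and cooling schedules -/

/-- The Boltzmann factor `e^{-b h}` of the energy `h` at inverse temperature `b ∈ [0, ∞]`, with the
usual convention at `b = ∞`: it is `1` for `h = 0` and `0` for `h > 0`. -/
def boltzmannWeight (b : ℝ≥0∞) (h : ℕ) : ℝ :=
  if b = ⊤ then (if h = 0 then 1 else 0) else Real.exp (-(b.toReal * h))

/-- The partition function `Z(b) = ∑ₓ e^{-b H(x)}` of a Hamiltonian `H : Ω → {0, …, n}`. -/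
def partitionFunction {Ω : Type} [Fintype Ω] {n : ℕ} (H : Ω → Fin (n + 1)) (b : ℝ≥0∞) : ℝ :=
  ∑ x, boltzmannWeight b (H x)

/-- The Gibbs distribution at inverse temperature `b`. -/
def gibbsDistribution {Ω : Type} [Fintype Ω] {n : ℕ} (H : Ω → Fin (n + 1)) (b : ℝ≥0∞) (x : Ω) : ℝ :=
  boltzmannWeight b (H x) / partitionFunction H b

/-- `0 = β₀ < β₁ < ⋯ < β_ℓ = ∞` is a `B`-Chebyshev cooling schedule for the partition function of
`H`. The field `ground_pos` says that the quotients in the last field are defined: `Z(∞)` is the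
only value of `Z` that can vanish. -/
structure IsChebyshevSchedule {Ω : Type} [Fintype Ω] {n : ℕ} (H : Ω → Fin (n + 1)) {l : ℕ}
    (β : Fin (l + 1) → ℝ≥0∞) (B : ℝ) : Prop where
  zero : β 0 = 0
  strictMono : StrictMono β
  last : β (Fin.last l) = ⊤
  ground_pos : 0 < partitionFunction H ⊤
  ratio_le : ∀ i : Fin l,
    partitionFunction H (2 * β i.succ - β i.castSucc) * partitionFunction H (β i.castSucc)
      / partitionFunction H (β i.succ) ^ 2 ≤ B

/-- The indices `1, …, ℓ - 1` of the temperatures strictly between `β₀ = 0` and `β_ℓ = ∞`. -/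
abbrev InteriorIndex (l : ℕ) : Type := {i : Fin (l + 1) // i ≠ 0 ∧ i ≠ Fin.last l}

/-! ### Quantum algorithms with black boxes -/

/-- A quantum algorithm on a memory with finite computational basis `K`, with access to black boxes
named by `Q`: it applies unitary gates, calls black boxes, measures functions of the basis label
(a partial measurement in the computational basis), continuing according to the outcome, and
finally outputs a real number. Gates, branching and outputs are fixed in advance: only the calls
depend on what is in the black boxes. -/
inductive QuantumProgram (K Q : Type) [Fintype K] [DecidableEq K] : Type
  | output (r : ℝ) : QuantumProgram K Q
  | gate (V : Matrix.unitaryGroup K ℂ) (next : QuantumProgram K Q) : QuantumProgram K Q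
  | query (q : Q) (next : QuantumProgram K Q) : QuantumProgram K Q
  | measure {m : ℕ} (f : K → Fin m) (next : Fin m → QuantumProgram K Q) : QuantumProgram K Q

namespace QuantumProgram

variable {K Q : Type} [Fintype K] [DecidableEq K]

open Classical in
/-- The probability that the output lies in `E`, when the black box `q` acts on state vectors as
`O q` and the memory is in the state `ψ`. Measuring `f` with outcome `o` leaves the unnormalised
state that is the projection of `ψ` to the basis vectors with `f k = o`; the squared norm of the
final vector is the probability of the branch. -/
def prob (O : Q → (K → ℂ) → (K → ℂ)) (E : Set ℝ) : QuantumProgram K Q → (K → ℂ) → ℝ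
  | output r, ψ => if r ∈ E then ∑ k, ‖ψ k‖ ^ 2 else 0
  | gate V next, ψ => prob O E next ((V : Matrix K K ℂ).mulVec ψ)
  | query q next, ψ => prob O E next (O q ψ)
  | measure f next, ψ => ∑ o, prob O E (next o) (fun k => if f k = o then ψ k else 0)

/-- The largest number, over all measurement outcomes, of calls to black boxes with a name
in `T`. -/
def queryCount (T : Q → Bool) : QuantumProgram K Q → ℕ
  | output _ => 0
  | gate _ next => queryCount T next
  | query q next => (if T q then 1 else 0) + queryCount T next
  | measure _ next => Finset.univ.sup fun o => queryCount T (next o)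

end QuantumProgram

/-! ### Access to Gibbs samples and to energies -/

/-- The black boxes: for each `i`, the unitary part of the sampling algorithm for `π_i`, and its
inverse; the evaluation of the Hamiltonian, and its inverse. -/
inductive GibbsQuery (ι : Type) : Type
  | sample (i : ι) : GibbsQuery ι
  | sampleInv (i : ι) : GibbsQuery ι
  | energy : GibbsQuery ι
  | energyInv : GibbsQuery ι

namespace GibbsQuery

/-- Uses of a sampling algorithm or of its inverse. -/
def isSample {ι : Type} : GibbsQuery ι → Bool
  | sample _ => true
  | sampleInv _ => true
  | energy => false
  | energyInv => false

/-- Evaluations of the Hamiltonian. -/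
def isEnergy {ι : Type} (q : GibbsQuery ι) : Bool := !q.isSample

end GibbsQuery

/-- An algorithm that samples from the distribution `p` on `Ω` exactly: apply the unitary `U` to the
basis state `s₀`, measure in the computational basis, and output `φ s`, where `s` is the outcome. -/
def IsExactSampler {S Ω : Type} [Fintype S] [DecidableEq S] [DecidableEq Ω] (s₀ : S) (φ : S → Ω)
    (U : Matrix.unitaryGroup S ℂ) (p : Ω → ℝ) : Prop :=
  ∀ x, ∑ s with φ s = x, ‖(U : Matrix S S ℂ) s s₀‖ ^ 2 = p x

/-- The memory has a register `S` for the sampling algorithms, a register `Ω` for a configuration,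
a register for an energy, and a workspace `W`. -/
abbrev GibbsMemory (S Ω : Type) (n : ℕ) (W : Type) : Type := S × Ω × Fin (n + 1) × W

/-- The action of a unitary on the register `S`. -/
def applySampler {S R : Type} [Fintype S] [DecidableEq S] (U : Matrix.unitaryGroup S ℂ)
    (ψ : S × R → ℂ) : S × R → ℂ :=
  fun k => ∑ s, (U : Matrix S S ℂ) k.1 s * ψ (s, k.2)

/-- The action of the black boxes on state vectors. Evaluating the Hamiltonian maps the basis state
`|s, x, j, w⟩` to `|s, x, j + H(x) mod (n + 1), w⟩`. -/
def gibbsOracle {S Ω W ι : Type} {n : ℕ} [Fintype S] [DecidableEq S]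
    (H : Ω → Fin (n + 1)) (U : ι → Matrix.unitaryGroup S ℂ) :
    GibbsQuery ι → (GibbsMemory S Ω n W → ℂ) → (GibbsMemory S Ω n W → ℂ)
  | .sample i, ψ => applySampler (U i) ψ
  | .sampleInv i, ψ => applySampler (U i)⁻¹ ψ
  | .energy, ψ => fun k => ψ (k.1, k.2.1, k.2.2.1 - H k.2.1, k.2.2.2)
  | .energyInv, ψ => fun k => ψ (k.1, k.2.1, k.2.2.1 + H k.2.1, k.2.2.2)

/-- A quantum algorithm with access to samplers indexed by `ι` and to energies: a finite workspace,
the basis state in which the memory starts, and a program. -/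
structure GibbsAlgorithm (S Ω : Type) (n : ℕ) (ι : Type) [Fintype S] [DecidableEq S]
    [Fintype Ω] [DecidableEq Ω] : Type 1 where
  W : Type
  [fintypeW : Fintype W]
  [decidableEqW : DecidableEq W]
  start : GibbsMemory S Ω n W
  program : QuantumProgram (GibbsMemory S Ω n W) (GibbsQuery ι)

namespace GibbsAlgorithm

variable {S Ω ι : Type} {n : ℕ} [Fintype S] [DecidableEq S] [Fintype Ω] [DecidableEq Ω]

/-- The probability that the output lies in `E`, for the Hamiltonian `H` and the samplers `U`. -/
def prob (alg : GibbsAlgorithm S Ω n ι) (H : Ω → Fin (n + 1))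
    (U : ι → Matrix.unitaryGroup S ℂ) (E : Set ℝ) : ℝ :=
  letI := alg.fintypeW
  letI := alg.decidableEqW
  alg.program.prob (gibbsOracle H U) E (Pi.single alg.start 1)

/-- The worst-case number of samples, that is, of uses of the samplers and their inverses. -/
def sampleCount (alg : GibbsAlgorithm S Ω n ι) : ℕ :=
  letI := alg.fintypeW
  letI := alg.decidableEqW
  alg.program.queryCount GibbsQuery.isSample

/-- The worst-case number of evaluations of the Hamiltonian. -/
def energyCount (alg : GibbsAlgorithm S Ω n ι) : ℕ :=
  letI := alg.fintypeW
  letI := alg.decidableEqW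
  alg.program.queryCount GibbsQuery.isEnergy

end GibbsAlgorithm

/-! ### The sample bound -/

/-- The logarithm as it is meant inside `O(·)`: bounded below by `1`. -/
def logO (x : ℝ) : ℝ := max 1 (Real.log x)

/-- `(B ℓ² log ℓ / ε) · log^{3/2}(B ℓ / ε) · log log (B ℓ / ε)`. -/
def chebyshevSampleBound (B : ℝ) (l : ℕ) (ε : ℝ) : ℝ :=
  B * (l : ℝ) ^ 2 * logO l / ε * logO (B * l / ε) ^ (3 / 2 : ℝ) * logO (logO (B * l / ε))

end

noncomputable section

open Matrix

/-! The partition function telescopes: `Z(∞) = |Ω| · ∏ Z(β_{i+1}) / Z(β_i)`, and each factor is the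
mean `μ_i` under `π_i` of `X_i = exp(-(β_{i+1} - β_i) H)`. The Chebyshev condition says exactly that
`E X_i² ≤ B μ_i²` (`sum_gibbs_mul_ratio`, `sum_gibbs_mul_ratio_sq`). Relative errors with sum at
most `ε/2` give a product with relative error at most `ε` (`abs_prod_sub_le`). By Markov's
inequality it therefore suffices that the relative errors, each capped at `ε`, have expectations
with sum at most `ε/8` (`IsChebyshevSchedule.coolingAlgorithm_prob`). Since only expectations are
added up, no amplification by medians is needed.

One mean is estimated in two stages (`meanRoutine_realizes`). The mean `m` of `N` ordinary samples
gives the scale; thanks to the cap, a wrong scale costs only `ε`, so `N` of order `Bℓ` is enough.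
Then `X/m` is split by dyadic size into functions with values in `[0,1]`, and the mean `p_k` of each
level is found by amplitude estimation with expected error of order `√p_k/q + 1/q²`. As `∑ 4^k p_k`
is of order `B`, Cauchy–Schwarz over the `K + 1` levels gives the error `√((K+1)B)/q`, up to
constants, plus smaller and truncation terms (`dyadic_relative_error`). With `D = Bℓ/ε`, `2^K` of
order `D` and `q` of order `√K · D`, the cost `ℓ K q` is of order `ℓ D log^{3/2} D`.

Amplitude estimation must have a small mean square error, while a uniform superposition on the
counter produces heavy tails. The counter therefore gets the smooth amplitudes `window`. Multiplying
by the estimate minus `p` after the Fourier transform is a second-difference operator before it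
(`phaseEstimate_sub_mul`). The Grover orbit satisfies `v (t+2) + v t = (2 - 4p) v (t+1)`
(`orbit_grover_recurrence`), so on `window · v` this operator leaves only differences of the window.
Parseval then bounds the mean square error by a multiple of `p/q² + 1/q⁴`
(`amplitudeCircuit_sq_error`), without any spectral decomposition. -/

/-! ### Expectations -/

/-- A normalised positive linear functional on the real functions on `α`. -/
structure Expectation (α : Type*) extends (α → ℝ) →ₗ[ℝ] ℝ where
  nonneg' : ∀ f : α → ℝ, 0 ≤ f → 0 ≤ toFun f
  one' : toFun (fun _ => 1) = 1

namespace Expectation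

variable {α β : Type*}

instance : CoeFun (Expectation α) fun _ => (α → ℝ) → ℝ := ⟨fun μ => μ.toLinearMap⟩

theorem add (μ : Expectation α) (f g : α → ℝ) : (μ fun a => f a + g a) = μ f + μ g :=
  μ.toLinearMap.map_add f g

theorem sub (μ : Expectation α) (f g : α → ℝ) : (μ fun a => f a - g a) = μ f - μ g :=
  μ.toLinearMap.map_sub f g

theorem const_mul (μ : Expectation α) (c : ℝ) (f : α → ℝ) : (μ fun a => c * f a) = c * μ f :=
  μ.toLinearMap.map_smul c f

theorem sum (μ : Expectation α) {ι : Type*} (s : Finset ι) (f : ι → α → ℝ) :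
    (μ fun a => ∑ i ∈ s, f i a) = ∑ i ∈ s, μ (f i) := by
  rw [← map_sum]
  congr 1
  funext a
  simp

theorem const (μ : Expectation α) (c : ℝ) : (μ fun _ => c) = c := by
  have h1 : (μ fun _ => (1 : ℝ)) = 1 := μ.one'
  have := μ.const_mul c fun _ => 1
  simpa [h1] using this

theorem nonneg (μ : Expectation α) {f : α → ℝ} (h : ∀ a, 0 ≤ f a) : 0 ≤ μ f := μ.nonneg' f h

theorem mono (μ : Expectation α) {f g : α → ℝ} (h : ∀ a, f a ≤ g a) : μ f ≤ μ g := by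
  have := μ.nonneg (f := fun a => g a - f a) fun a => sub_nonneg.2 (h a)
  rw [sub] at this
  linarith

/-- The expectation for finitely many weights. -/
def ofWeights {ι : Type*} [Fintype ι] (w : ι → ℝ) (hw : ∀ i, 0 ≤ w i) (h1 : ∑ i, w i = 1)
    (v : ι → α) : Expectation α where
  toFun f := ∑ i, w i * f (v i)
  map_add' f g := by simp [mul_add, Finset.sum_add_distrib]
  map_smul' c f := by
    simp only [Pi.smul_apply, smul_eq_mul, RingHom.id_apply, Finset.mul_sum]
    exact Finset.sum_congr rfl fun _ _ => by ring
  nonneg' f hf := Finset.sum_nonneg fun i _ => mul_nonneg (hw i) (hf _)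
  one' := by simpa using h1

/-- The expectation at a point. -/
def dirac (a : α) : Expectation α where
  toFun f := f a
  map_add' _ _ := rfl
  map_smul' _ _ := rfl
  nonneg' _ hf := hf a
  one' := rfl

/-- The expectation for two successive random choices. -/
def bind (μ : Expectation α) (ν : α → Expectation β) : Expectation β where
  toFun f := μ fun a => ν a f
  map_add' f g := by simp only [map_add]; exact μ.add _ _
  map_smul' c f := by simp only [map_smul]; exact μ.const_mul _ _
  nonneg' _ hf := μ.nonneg fun a => (ν a).nonneg hf
  one' := by
    have : (fun a => ν a fun _ => (1 : ℝ)) = fun _ => 1 := funext fun a => (ν a).one'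
    exact (congrArg _ this).trans μ.one'

/-- The expectation for the image under a map. -/
def map (f : α → β) (μ : Expectation α) : Expectation β := μ.bind fun a => dirac (f a)

theorem bind_apply (μ : Expectation α) (ν : α → Expectation β) (f : β → ℝ) :
    μ.bind ν f = μ fun a => ν a f := rfl

theorem map_apply (g : α → β) (μ : Expectation α) (f : β → ℝ) :
    μ.map g f = μ fun a => f (g a) := rfl

/-- The expectation for independent random choices. -/
def pi : {k : ℕ} → (Fin k → Expectation α) → Expectation (Fin k → α)
  | 0, _ => dirac Fin.elim0
  | _ + 1, μ => (μ 0).bind fun a => (pi fun i => μ i.succ).map (Fin.cons a)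

theorem pi_succ {k : ℕ} (μ : Fin (k + 1) → Expectation α) (f : (Fin (k + 1) → α) → ℝ) :
    pi μ f = μ 0 fun a => (pi fun i => μ i.succ) fun b => f (Fin.cons a b) := rfl

theorem pi_eval {k : ℕ} (μ : Fin k → Expectation α) (i : Fin k) (f : α → ℝ) :
    (pi μ fun a => f (a i)) = μ i f := by
  induction k with
  | zero => exact i.elim0
  | succ k ih =>
    rw [pi_succ]
    refine Fin.cases ?_ (fun j => ?_) i
    · simp only [Fin.cons_zero, const]
    · simp only [Fin.cons_succ, ih, const]

/-- Independent centred terms: the cross terms vanish, so second moments add. -/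
theorem pi_sum_sq {k : ℕ} (μ : Expectation α) {f : α → ℝ} (hf : μ f = 0) :
    (pi (fun _ : Fin k => μ) fun a => (∑ i, f (a i)) ^ 2) = k * μ fun a => f a ^ 2 := by
  induction k with
  | zero => simp [pi, dirac]
  | succ k ih =>
    rw [pi_succ]
    have h1 : ∀ a, ((pi fun _ : Fin k => μ) fun b =>
        (∑ i, f ((Fin.cons a b : Fin (k + 1) → α) i)) ^ 2)
          = f a ^ 2 + k * μ fun a => f a ^ 2 := by
      intro a
      rw [← ih]
      have h2 : (fun b : Fin k → α => (∑ i, f ((Fin.cons a b : Fin (k + 1) → α) i)) ^ 2)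
          = fun b => f a ^ 2 + ((2 * f a) * (∑ i, f (b i)) + (∑ i, f (b i)) ^ 2) := by
        funext b
        rw [Fin.sum_univ_succ]
        simp only [Fin.cons_zero, Fin.cons_succ]
        ring
      rw [h2, add, add, const, const_mul, sum]
      simp only [pi_eval (fun _ : Fin k => μ) _ f, hf]
      simp
    simp only [h1, add, const]
    push_cast
    ring

end Expectation

/-! ### Unitary gates -/

section Gates

variable {K R X m o : Type} [Fintype K]

/-- The square of the norm of a state vector. -/
def stateNormSq (ψ : K → ℂ) : ℝ := ∑ k, ‖ψ k‖ ^ 2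

theorem coe_stateNormSq (ψ : K → ℂ) : (stateNormSq ψ : ℂ) = star ψ ⬝ᵥ ψ := by
  simp [stateNormSq, dotProduct, Complex.conj_mul']

/-- The state on `R × X` with components `Φ x`. -/
def pack (e : K ≃ R × X) (Φ : X → R → ℂ) : K → ℂ := fun k => Φ (e k).2 (e k).1

theorem sum_pack [Fintype R] [Fintype X] (e : K ≃ R × X) (Φ : X → R → ℂ) (g : X → ℝ) :
    ∑ k, ‖pack e Φ k‖ ^ 2 * g (e k).2 = ∑ x, stateNormSq (Φ x) * g x := by
  rw [← e.symm.sum_comp, Fintype.sum_prod_type_right]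
  simp [pack, stateNormSq, Finset.sum_mul]

/-- The distribution of the result of measuring a state. -/
def measureExpectation {α : Type} (ψ : K → ℂ) (hψ : stateNormSq ψ = 1) (v : K → α) :
    Expectation α :=
  Expectation.ofWeights (fun k => ‖ψ k‖ ^ 2) (fun _ => by positivity) hψ v

theorem measureExpectation_apply {α : Type} (ψ : K → ℂ) (hψ : stateNormSq ψ = 1) (v : K → α)
    (f : α → ℝ) : measureExpectation ψ hψ v f = ∑ k, ‖ψ k‖ ^ 2 * f (v k) := rfl

variable [DecidableEq K] [Fintype R] [DecidableEq R]
  [Fintype X] [DecidableEq X] [Fintype m] [DecidableEq m] [Fintype o] [DecidableEq o]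

theorem unitary_inv_mulVec_mulVec (V : unitaryGroup K ℂ) (ψ : K → ℂ) :
    ((V⁻¹ : unitaryGroup K ℂ) : Matrix K K ℂ) *ᵥ ((V : Matrix K K ℂ) *ᵥ ψ) = ψ := by
  rw [mulVec_mulVec, ← UnitaryGroup.mul_val, inv_mul_cancel, UnitaryGroup.one_val, one_mulVec]

theorem stateNormSq_mulVec (V : unitaryGroup K ℂ) (ψ : K → ℂ) :
    stateNormSq ((V : Matrix K K ℂ) *ᵥ ψ) = stateNormSq ψ := by
  have h : (stateNormSq ((V : Matrix K K ℂ) *ᵥ ψ) : ℂ) = stateNormSq ψ := by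
    rw [coe_stateNormSq, coe_stateNormSq, star_mulVec, ← dotProduct_mulVec, mulVec_mulVec,
      ← star_eq_conjTranspose, UnitaryGroup.star_mul_self, one_mulVec]
  exact_mod_cast h

theorem stateNormSq_single (k : K) : stateNormSq (Pi.single k (1 : ℂ)) = 1 := by
  simp [stateNormSq, Pi.single_apply, apply_ite]

/-- The gate that acts on the first factor of `m × o` by a unitary which may depend on the second
factor. -/
def controlledGate (e : K ≃ m × o) (V : o → unitaryGroup m ℂ) : unitaryGroup K ℂ :=
  ⟨(blockDiagonal fun i => (V i : Matrix m m ℂ)).submatrix e e, by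
    rw [mem_unitaryGroup_iff, star_eq_conjTranspose, conjTranspose_submatrix,
      submatrix_mul_equiv, blockDiagonal_conjTranspose, ← blockDiagonal_mul]
    have : (fun k => (V k : Matrix m m ℂ) * (V k : Matrix m m ℂ)ᴴ) = 1 := by
      funext k
      exact mem_unitaryGroup_iff.1 (V k).2
    rw [this, blockDiagonal_one, submatrix_one_equiv]⟩

theorem controlledGate_mulVec (e : K ≃ m × o) (V : o → unitaryGroup m ℂ) (ψ : K → ℂ) (k : K) :
    ((controlledGate e V : Matrix K K ℂ) *ᵥ ψ) k
      = ∑ i, (V (e k).2 : Matrix m m ℂ) (e k).1 i * ψ (e.symm (i, (e k).2)) := by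
  simp only [controlledGate, mulVec, dotProduct, submatrix_apply, blockDiagonal_apply]
  rw [← e.symm.sum_comp, Fintype.sum_prod_type]
  refine Finset.sum_congr rfl fun i _ => ?_
  rw [Finset.sum_eq_single (e k).2] <;> simp +contextual [eq_comm]

/-- The gate that permutes the computational basis. -/
def permutationGate (σ : Equiv.Perm K) : unitaryGroup K ℂ :=
  ⟨(1 : Matrix K K ℂ).submatrix σ id, by
    rw [mem_unitaryGroup_iff, star_eq_conjTranspose, conjTranspose_submatrix]
    simp only [conjTranspose_one]
    have := submatrix_mul_equiv (1 : Matrix K K ℂ) 1 σ (Equiv.refl K) σ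
    simp only [Equiv.coe_refl] at this
    rw [this, mul_one, submatrix_one_equiv]⟩

theorem permutationGate_mulVec (σ : Equiv.Perm K) (ψ : K → ℂ) (k : K) :
    ((permutationGate σ : Matrix K K ℂ) *ᵥ ψ) k = ψ (σ k) := by
  simp [permutationGate, mulVec, dotProduct, Matrix.one_apply]

/-- The gate that changes the sign of some basis vectors. -/
def signGate (s : K → Bool) : unitaryGroup K ℂ :=
  ⟨diagonal fun k => if s k then -1 else 1, by
    rw [mem_unitaryGroup_iff, star_eq_conjTranspose, diagonal_conjTranspose,
      diagonal_mul_diagonal, ← diagonal_one]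
    congr 1
    funext k
    by_cases hk : s k <;> simp [hk]⟩

theorem signGate_mulVec (s : K → Bool) (ψ : K → ℂ) (k : K) :
    ((signGate s : Matrix K K ℂ) *ᵥ ψ) k = if s k then -ψ k else ψ k := by
  simp [signGate, mulVec_diagonal, ite_mul]

/-- Every unit vector is the image of a given basis vector under some unitary. -/
theorem exists_unitary_column (k₀ : K) (v : K → ℂ) (hv : stateNormSq v = 1) :
    ∃ V : unitaryGroup K ℂ, ∀ k, (V : Matrix K K ℂ) k k₀ = v k := by
  -- One unit vector is an orthonormal family indexed by `{k₀}`; it extends to a basis indexed by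
  -- `K`, whose coordinate matrix is the unitary.
  have hon : Orthonormal ℂ (({k₀} : Set K).domRestrict
      (fun _ : K => (WithLp.toLp 2 v : EuclideanSpace ℂ K))) := by
    refine ⟨fun i => ?_, fun i j hij => (hij (Subsingleton.elim i j)).elim⟩
    simp only [EuclideanSpace.norm_eq]
    rw [Real.sqrt_eq_one]
    exact hv
  obtain ⟨b, hb⟩ := hon.exists_orthonormalBasis_extension_of_card_eq (by simp)
  refine ⟨⟨(EuclideanSpace.basisFun K ℂ).toBasis.toMatrix b,
    (EuclideanSpace.basisFun K ℂ).toMatrix_orthonormalBasis_mem_unitary b⟩, fun k => ?_⟩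
  have h0 := hb k₀ (Set.mem_singleton _)
  simp [Module.Basis.toMatrix_apply, h0]

/-- A unitary that maps the basis vector `k₀` to `v`, if `v` is a unit vector. -/
def prepareGate (k₀ : K) (v : K → ℂ) : unitaryGroup K ℂ :=
  open Classical in if hv : stateNormSq v = 1 then (exists_unitary_column k₀ v hv).choose else 1

theorem prepareGate_apply {k₀ : K} {v : K → ℂ} (hv : stateNormSq v = 1) (k : K) :
    (prepareGate k₀ v : Matrix K K ℂ) k k₀ = v k := by
  rw [prepareGate, dif_pos hv]
  exact (exists_unitary_column k₀ v hv).choose_spec k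

theorem controlledGate_mulVec_pack (e : K ≃ R × X) (V : X → unitaryGroup R ℂ) (Φ : X → R → ℂ) :
    (controlledGate e V : Matrix K K ℂ) *ᵥ pack e Φ
      = pack e fun x => (V x : Matrix R R ℂ) *ᵥ Φ x := by
  funext k
  rw [controlledGate_mulVec]
  simp [pack, mulVec, dotProduct]

theorem controlledGate_swap_mulVec_pack (e : K ≃ R × X) (F : unitaryGroup X ℂ) (Φ : X → R → ℂ) :
    (controlledGate (e.trans (Equiv.prodComm R X)) fun _ => F : Matrix K K ℂ) *ᵥ pack e Φ
      = pack e fun y r => ∑ x, (F : Matrix X X ℂ) y x * Φ x r := by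
  funext k
  rw [controlledGate_mulVec]
  simp [pack]

end Gates

/-! ### Circuits -/

/-- A sequence of unitary gates and calls to black boxes. -/
abbrev Circuit (K Q : Type) [Fintype K] [DecidableEq K] : Type := List (unitaryGroup K ℂ ⊕ Q)

namespace Circuit

variable {K Q R : Type} [Fintype K] [DecidableEq K] [Fintype R] [DecidableEq R]

/-- The unitary that a circuit implements when the black box `q` implements `N q`. -/
def eval (N : Q → unitaryGroup K ℂ) : Circuit K Q → unitaryGroup K ℂ
  | [] => 1
  | .inl V :: c => eval N c * V
  | .inr q :: c => eval N c * N q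

/-- The number of calls to black boxes with a name in `T`. -/
def count (T : Q → Bool) : Circuit K Q → ℕ
  | [] => 0
  | .inl _ :: c => count T c
  | .inr q :: c => (if T q then 1 else 0) + count T c

/-- Run a circuit, then continue. -/
def thenRun (c : Circuit K Q) (P : QuantumProgram K Q) : QuantumProgram K Q :=
  c.foldr (fun s P => s.elim (fun V => .gate V P) fun q => .query q P) P

/-- The circuit for the inverse unitary, when the inverse of the black box `q` is `inv q`. -/
def inverse (inv : Q → Q) (c : Circuit K Q) : Circuit K Q :=
  (c.map (Sum.map (·⁻¹) inv)).reverse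

/-- A circuit on `R`, with gates mapped to gates on `K`. -/
def mapGates (L : unitaryGroup R ℂ → unitaryGroup K ℂ) (c : Circuit R Q) : Circuit K Q :=
  c.map (Sum.map L id)

theorem eval_append (N : Q → unitaryGroup K ℂ) (c d : Circuit K Q) :
    eval N (c ++ d) = eval N d * eval N c := by
  induction c with
  | nil => simp [eval]
  | cons s c ih => cases s <;> simp [eval, ih, mul_assoc]

theorem count_append (T : Q → Bool) (c d : Circuit K Q) :
    count T (c ++ d) = count T c + count T d := by
  induction c with
  | nil => simp [count]
  | cons s c ih => cases s <;> simp [count, ih, add_assoc]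

theorem eval_inverse {N : Q → unitaryGroup K ℂ} {inv : Q → Q} (h : ∀ q, N (inv q) = (N q)⁻¹)
    (c : Circuit K Q) : eval N (c.inverse inv) = (eval N c)⁻¹ := by
  induction c with
  | nil => simp [eval, inverse]
  | cons s c ih =>
    have : inverse inv (s :: c) = inverse inv c ++ [Sum.map (·⁻¹) inv s] := by simp [inverse]
    rw [this, eval_append, ih]
    cases s <;> simp [eval, h]

theorem count_inverse {T : Q → Bool} {inv : Q → Q} (h : ∀ q, T (inv q) = T q)
    (c : Circuit K Q) : count T (c.inverse inv) = count T c := by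
  induction c with
  | nil => simp [inverse]
  | cons s c ih =>
    have : inverse inv (s :: c) = inverse inv c ++ [Sum.map (·⁻¹) inv s] := by simp [inverse]
    rw [this, count_append, ih]
    cases s <;> simp [count, h, add_comm]

theorem eval_mapGates {N : Q → unitaryGroup R ℂ} {N' : Q → unitaryGroup K ℂ}
    (L : unitaryGroup R ℂ →* unitaryGroup K ℂ) (h : ∀ q, N' q = L (N q)) (c : Circuit R Q) :
    eval N' (c.mapGates L) = L (eval N c) := by
  induction c with
  | nil => simp [eval, mapGates]
  | cons s c ih =>
    have : mapGates L (s :: c) = Sum.map L id s :: mapGates L c := rfl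
    rw [this]
    cases s <;> simp [eval, ih, h]

theorem count_mapGates (T : Q → Bool) (L : unitaryGroup R ℂ → unitaryGroup K ℂ)
    (c : Circuit R Q) : count T (c.mapGates L) = count T c := by
  induction c with
  | nil => simp [mapGates, count]
  | cons s c ih =>
    have : mapGates L (s :: c) = Sum.map L id s :: mapGates L c := rfl
    rw [this]
    cases s <;> simp [count, ih]

theorem queryCount_thenRun (T : Q → Bool) (c : Circuit K Q) (P : QuantumProgram K Q) :
    (c.thenRun P).queryCount T = c.count T + P.queryCount T := by
  induction c with
  | nil => simp [thenRun, count]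
  | cons s c ih =>
    cases s <;> simp_all [thenRun, count, QuantumProgram.queryCount, add_assoc]

theorem prob_thenRun {O : Q → (K → ℂ) → (K → ℂ)} {N : Q → unitaryGroup K ℂ}
    (h : ∀ q ψ, O q ψ = (N q : Matrix K K ℂ) *ᵥ ψ) (E : Set ℝ) (c : Circuit K Q)
    (P : QuantumProgram K Q) (ψ : K → ℂ) :
    (c.thenRun P).prob O E ψ = P.prob O E ((eval N c : Matrix K K ℂ) *ᵥ ψ) := by
  induction c generalizing ψ with
  | nil => simp [thenRun, eval]
  | cons s c ih =>
    cases s <;> simp_all [thenRun, eval, QuantumProgram.prob]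

end Circuit

/-! ### Randomised routines -/

/-- A program with a hole: what happens with the result of type `α` is left open. -/
abbrev Routine (K Q α : Type) [Fintype K] [DecidableEq K] : Type :=
  (α → QuantumProgram K Q) → QuantumProgram K Q

namespace Routine

variable {K Q α β : Type} [Fintype K] [DecidableEq K]

/-- The routine calls black boxes with a name in `T` at most `n` times. -/
def CostLE (P : Routine K Q α) (T : Q → Bool) (n : ℕ) : Prop :=
  ∀ c b, (∀ a, (c a).queryCount T ≤ b) → (P c).queryCount T ≤ n + b

/-- Started in the basis state `k₀`, the routine returns to it, with a random result described
by `μ`. -/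
def Realizes (P : Routine K Q α) (O : Q → (K → ℂ) → (K → ℂ)) (k₀ : K) (μ : Expectation α) :
    Prop :=
  ∀ E c, (P c).prob O E (Pi.single k₀ 1) = μ fun a => (c a).prob O E (Pi.single k₀ 1)

/-- Run one routine, then another. -/
def bind (P : Routine K Q α) (f : α → Routine K Q β) : Routine K Q β :=
  fun c => P fun a => f a c

/-- Apply a function to the result. -/
def map (f : α → β) (P : Routine K Q α) : Routine K Q β := fun c => P fun a => c (f a)

/-- Run routines one after the other. -/
def pi : {k : ℕ} → (Fin k → Routine K Q α) → Routine K Q (Fin k → α)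
  | 0, _ => fun c => c Fin.elim0
  | _ + 1, P => bind (P 0) fun a => map (Fin.cons a) (pi fun i => P i.succ)

theorem CostLE.bind {P : Routine K Q α} {f : α → Routine K Q β} {T : Q → Bool} {m n : ℕ}
    (hP : P.CostLE T m) (hf : ∀ a, (f a).CostLE T n) : (P.bind f).CostLE T (m + n) := by
  intro c b h
  rw [add_assoc]
  exact hP _ _ fun a => hf a c b h

theorem CostLE.map {P : Routine K Q α} {T : Q → Bool} {n : ℕ} (hP : P.CostLE T n)
    (f : α → β) : (P.map f).CostLE T n := fun _ _ h => hP _ _ fun _ => h _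

theorem CostLE.pi {k : ℕ} {P : Fin k → Routine K Q α} {T : Q → Bool} {n : ℕ}
    (hP : ∀ i, (P i).CostLE T n) : (Routine.pi P).CostLE T (k * n) := by
  induction k with
  | zero => intro c b h; simpa using! h _
  | succ k ih =>
    have : (k + 1) * n = n + k * n := by ring
    intro c b h
    rw [this]
    refine CostLE.bind (hP 0) (fun a => ?_) c b h
    exact (ih fun i => hP i.succ).map _

variable {O : Q → (K → ℂ) → (K → ℂ)} {k₀ : K}

/-- Since the first routine ends in `k₀` again, its result is all that is passed on, and sequencing
becomes composition of random choices. -/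
theorem Realizes.bind {P : Routine K Q α} {f : α → Routine K Q β} {μ : Expectation α}
    {ν : α → Expectation β} (hP : P.Realizes O k₀ μ) (hf : ∀ a, (f a).Realizes O k₀ (ν a)) :
    (P.bind f).Realizes O k₀ (μ.bind ν) := by
  intro E c
  rw [Expectation.bind_apply]
  refine (hP E _).trans (congrArg _ (funext fun a => hf a E c))

theorem Realizes.map {P : Routine K Q α} {μ : Expectation α} (hP : P.Realizes O k₀ μ)
    (f : α → β) : (P.map f).Realizes O k₀ (μ.map f) := fun E c => hP E fun a => c (f a)

theorem Realizes.pi {k : ℕ} {P : Fin k → Routine K Q α} {μ : Fin k → Expectation α}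
    (hP : ∀ i, (P i).Realizes O k₀ (μ i)) : (Routine.pi P).Realizes O k₀ (Expectation.pi μ) := by
  induction k with
  | zero => intro E c; rfl
  | succ k ih => exact (hP 0).bind fun a => (ih fun i => hP i.succ).map _

end Routine

section Measure

variable {K Q α : Type} [Fintype K] [DecidableEq K]

/-- A complete measurement leaves a multiple of a basis vector; this extracts the multiple as the
probability of the outcome. -/
theorem QuantumProgram.prob_smul {O : Q → (K → ℂ) → (K → ℂ)} {N : Q → unitaryGroup K ℂ}
    (h : ∀ q ψ, O q ψ = (N q : Matrix K K ℂ) *ᵥ ψ) (E : Set ℝ) (P : QuantumProgram K Q)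
    (z : ℂ) (ψ : K → ℂ) : P.prob O E (z • ψ) = ‖z‖ ^ 2 * P.prob O E ψ := by
  induction P generalizing ψ with
  | output r =>
    simp only [prob, Pi.smul_apply, smul_eq_mul, norm_mul, mul_pow, ← Finset.mul_sum]
    split_ifs <;> simp
  | gate V P ih => simp only [prob, mulVec_smul, ih]
  | query q P ih => simp only [prob, h, mulVec_smul, ih]
  | measure f P ih =>
    simp only [prob, Finset.mul_sum]
    refine Finset.sum_congr rfl fun o _ => ?_
    rw [← ih]
    congr 1
    funext k
    simp

/-- Run a circuit, measure the memory in the computational basis, and reset it to `k₀`. -/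
def Circuit.sampleRoutine (c : Circuit K Q) (k₀ : K) (v : K → α) : Routine K Q α := fun P =>
  c.thenRun (.measure (Fintype.equivFin K) fun o =>
    .gate (permutationGate (Equiv.swap ((Fintype.equivFin K).symm o) k₀))
      (P (v ((Fintype.equivFin K).symm o))))

theorem Circuit.sampleRoutine_costLE (c : Circuit K Q) (k₀ : K) (v : K → α) (T : Q → Bool) :
    (c.sampleRoutine k₀ v).CostLE T (c.count T) := by
  intro P b h
  rw [sampleRoutine, queryCount_thenRun]
  simp only [QuantumProgram.queryCount]
  gcongr
  exact Finset.sup_le fun o _ => h _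

theorem Circuit.sampleRoutine_realizes {O : Q → (K → ℂ) → (K → ℂ)} {N : Q → unitaryGroup K ℂ}
    (h : ∀ q ψ, O q ψ = (N q : Matrix K K ℂ) *ᵥ ψ) (c : Circuit K Q) (k₀ : K) (v : K → α)
    {ψ : K → ℂ} (hc : (eval N c : Matrix K K ℂ) *ᵥ Pi.single k₀ 1 = ψ)
    (hψ : stateNormSq ψ = 1) :
    (c.sampleRoutine k₀ v).Realizes O k₀ (measureExpectation ψ hψ v) := by
  intro E P
  rw [sampleRoutine, prob_thenRun h, hc, measureExpectation_apply]
  simp only [QuantumProgram.prob]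
  rw [← (Fintype.equivFin K).sum_comp]
  refine Finset.sum_congr rfl fun k _ => ?_
  rw [← QuantumProgram.prob_smul h]
  simp only [Equiv.symm_apply_apply]
  congr 1
  funext j
  -- The projected state is `ψ k` times the basis vector `k`, which the swap moves to `k₀`.
  rw [permutationGate_mulVec]
  by_cases hj : j = k₀
  · subst hj; simp
  · have : Equiv.swap k k₀ j ≠ k := by
      intro h'
      rw [Equiv.swap_apply_eq_iff, Equiv.swap_apply_left] at h'
      exact hj h'
    simp [hj, this]

end Measure

/-! ### The Grover operator -/

section Grover

variable {R : Type} [Fintype R]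

/-- The probability that a measurement of `ψ` gives a marked basis vector. -/
def markedProb (χ : R → Bool) (ψ : R → ℂ) : ℝ := ∑ r, if χ r then ‖ψ r‖ ^ 2 else 0

theorem markedProb_nonneg (χ : R → Bool) (ψ : R → ℂ) : 0 ≤ markedProb χ ψ :=
  Finset.sum_nonneg fun r _ => by split_ifs <;> positivity

theorem markedProb_le (χ : R → Bool) (ψ : R → ℂ) : markedProb χ ψ ≤ stateNormSq ψ :=
  Finset.sum_le_sum fun r _ => by split_ifs <;> [exact le_rfl; positivity]

theorem stateNormSq_combination (u w : R → ℂ) (α β : ℝ) :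
    stateNormSq (fun r => α * u r + β * w r) = α ^ 2 * stateNormSq u + β ^ 2 * stateNormSq w
      + α * β * (stateNormSq (fun r => u r + w r) - stateNormSq u - stateNormSq w) := by
  simp only [stateNormSq, Finset.mul_sum, ← Finset.sum_sub_distrib, ← Finset.sum_add_distrib]
  refine Finset.sum_congr rfl fun r _ => ?_
  simp only [Complex.sq_norm, Complex.normSq_apply, Complex.add_re, Complex.add_im,
    Complex.re_ofReal_mul, Complex.im_ofReal_mul]
  ring

theorem stateNormSq_const_mul (z : ℂ) (u : R → ℂ) :
    stateNormSq (fun r => z * u r) = ‖z‖ ^ 2 * stateNormSq u := by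
  simp [stateNormSq, Finset.mul_sum, mul_pow]

/-- The recurrence gives `‖v (t+2) + v t‖ = |2 - 4p|`, so the squared norm is `(α+β)² - 16p(1-p)αβ`;
now use `-4αβ = (α-β)² - (α+β)²`. Later `α + β` is a second difference of the window, and `α - β` a
first difference, damped by `p`. -/
theorem stateNormSq_combination_le {v : ℕ → R → ℂ} {p : ℝ} (hp : 0 ≤ p) (hp1 : p ≤ 1)
    (hv : ∀ t, stateNormSq (v t) = 1)
    (hrec : ∀ t r, v (t + 2) r + v t r = (2 - 4 * p) * v (t + 1) r) (t : ℕ) (α β : ℝ) :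
    stateNormSq (fun r => α * v (t + 2) r + β * v t r)
      ≤ (α + β) ^ 2 + 4 * p * (α - β) ^ 2 := by
  have h : stateNormSq (fun r => v (t + 2) r + v t r) = (2 - 4 * p) ^ 2 := by
    simp only [hrec]
    have h2 : ((2 : ℂ) - 4 * p) = ((2 - 4 * p : ℝ) : ℂ) := by push_cast; ring
    rw [stateNormSq_const_mul, hv, h2, Complex.norm_real, Real.norm_eq_abs, sq_abs, mul_one]
  rw [stateNormSq_combination, h, hv, hv]
  nlinarith [mul_nonneg hp (add_nonneg (mul_nonneg (sub_nonneg.2 hp1) (sq_nonneg (α + β)))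
    (mul_nonneg hp (sq_nonneg (α - β))))]

variable [DecidableEq R]

/-- The Grover operator for the preparation `A` of a state and the marked basis vectors `χ`. -/
def groverGate (A : unitaryGroup R ℂ) (r₀ : R) (χ : R → Bool) : unitaryGroup R ℂ :=
  A * (signGate fun r => decide (r ≠ r₀)) * A⁻¹ * signGate χ

theorem reflection_mulVec (A : unitaryGroup R ℂ) (r₀ : R) (u : R → ℂ) :
    (A : Matrix R R ℂ) *ᵥ (((signGate fun r => decide (r ≠ r₀) : unitaryGroup R ℂ) :
        Matrix R R ℂ) *ᵥ (((A⁻¹ : unitaryGroup R ℂ) : Matrix R R ℂ) *ᵥ u))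
      = fun r => 2 * (∑ s, star ((A : Matrix R R ℂ) s r₀) * u s) * (A : Matrix R R ℂ) r r₀ - u r := by
  set w := ((A⁻¹ : unitaryGroup R ℂ) : Matrix R R ℂ) *ᵥ u with hw
  have h1 : ((signGate fun r => decide (r ≠ r₀) : unitaryGroup R ℂ) : Matrix R R ℂ) *ᵥ w
      = (2 * w r₀) • Pi.single r₀ 1 - w := by
    funext r
    rw [signGate_mulVec]
    by_cases hr : r = r₀
    · subst hr; simp; ring
    · simp [hr]
  have h2 : (A : Matrix R R ℂ) *ᵥ w = u := by
    have := unitary_inv_mulVec_mulVec A⁻¹ u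
    rwa [inv_inv] at this
  rw [h1, mulVec_sub, mulVec_smul, h2]
  funext r
  simp [hw, mulVec, dotProduct, Matrix.star_apply]

/-- The span of the marked and unmarked parts of `ψ` is invariant. In the coordinates `(a, b)` the
operator is a `2 × 2` matrix of trace `2 - 4p` and determinant `1`. -/
theorem groverGate_mulVec {A : unitaryGroup R ℂ} {r₀ : R} {ψ : R → ℂ}
    (hA : (A : Matrix R R ℂ) *ᵥ Pi.single r₀ 1 = ψ) (χ : R → Bool) (a b : ℂ) :
    (groverGate A r₀ χ : Matrix R R ℂ) *ᵥ (fun r => (if χ r then a else b) * ψ r)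
      = fun r => (if χ r then (1 - 2 * markedProb χ ψ) * a + 2 * (1 - markedProb χ ψ) * b
          else -2 * markedProb χ ψ * a + (1 - 2 * markedProb χ ψ) * b) * ψ r := by
  have hcol : ∀ r, (A : Matrix R R ℂ) r r₀ = ψ r := by
    intro r; rw [← hA]; simp
  have hnorm : stateNormSq ψ = 1 := by rw [← hA, stateNormSq_mulVec, stateNormSq_single]
  have hsplit : (∑ r, if χ r then 0 else ‖ψ r‖ ^ 2) = 1 - markedProb χ ψ := by
    rw [eq_sub_iff_add_eq, markedProb, ← Finset.sum_add_distrib, ← hnorm]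
    refine Finset.sum_congr rfl fun r _ => ?_
    split_ifs <;> simp
  rw [groverGate, UnitaryGroup.mul_val, UnitaryGroup.mul_val, UnitaryGroup.mul_val,
    ← mulVec_mulVec, ← mulVec_mulVec, ← mulVec_mulVec, reflection_mulVec]
  have hin : (∑ s, star ((A : Matrix R R ℂ) s r₀) *
      ((signGate χ : Matrix R R ℂ) *ᵥ (fun r => (if χ r then a else b) * ψ r)) s)
        = -a * markedProb χ ψ + b * (1 - markedProb χ ψ) := by
    have h1 : ((1 - markedProb χ ψ : ℝ) : ℂ) = 1 - markedProb χ ψ := by push_cast; ring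
    rw [← h1, ← hsplit, markedProb]
    push_cast
    rw [Finset.mul_sum, Finset.mul_sum, ← Finset.sum_add_distrib]
    refine Finset.sum_congr rfl fun s _ => ?_
    rw [signGate_mulVec, hcol]
    have := Complex.conj_mul' (ψ s)
    simp only [RCLike.star_def]
    split_ifs
    · push_cast; linear_combination (-a) * this
    · push_cast; linear_combination b * this
  funext r
  rw [hin, signGate_mulVec, hcol]
  split_ifs <;> ring

/-- The orbit of `ψ` under a unitary. -/
def orbit (G : unitaryGroup R ℂ) (ψ : R → ℂ) (t : ℕ) : R → ℂ :=
  ((G ^ t : unitaryGroup R ℂ) : Matrix R R ℂ) *ᵥ ψ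

theorem orbit_succ (G : unitaryGroup R ℂ) (ψ : R → ℂ) (t : ℕ) :
    orbit G ψ (t + 1) = (G : Matrix R R ℂ) *ᵥ orbit G ψ t := by
  rw [orbit, orbit, pow_succ', UnitaryGroup.mul_val, mulVec_mulVec]

theorem stateNormSq_orbit {G : unitaryGroup R ℂ} {ψ : R → ℂ} (hψ : stateNormSq ψ = 1) (t : ℕ) :
    stateNormSq (orbit G ψ t) = 1 := by rw [orbit, stateNormSq_mulVec, hψ]

/-- This is Cayley–Hamilton for the `2 × 2` matrix in `groverGate_mulVec`; it replaces the
eigenvectors and phases of the Grover operator. -/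
theorem orbit_grover_recurrence {A : unitaryGroup R ℂ} {r₀ : R} {ψ : R → ℂ}
    (hA : (A : Matrix R R ℂ) *ᵥ Pi.single r₀ 1 = ψ) (χ : R → Bool) (t : ℕ) (r : R) :
    orbit (groverGate A r₀ χ) ψ (t + 2) r + orbit (groverGate A r₀ χ) ψ t r
      = (2 - 4 * markedProb χ ψ) * orbit (groverGate A r₀ χ) ψ (t + 1) r := by
  have key : ∀ t, ∃ a b : ℂ, orbit (groverGate A r₀ χ) ψ t
      = fun r => (if χ r then a else b) * ψ r := by
    intro t
    induction t with
    | zero => exact ⟨1, 1, by simp [orbit]⟩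
    | succ t ih =>
      obtain ⟨a, b, h⟩ := ih
      rw [orbit_succ, h, groverGate_mulVec hA]
      exact ⟨_, _, rfl⟩
  obtain ⟨a, b, h⟩ := key t
  rw [orbit_succ, orbit_succ, h, groverGate_mulVec hA, groverGate_mulVec hA]
  dsimp only
  split_ifs <;> ring

end Grover

/-! ### The Fourier transform on the counter -/

section Fourier

variable {M : ℕ} [NeZero M] {R : Type} [Fintype R]

/-- The Fourier transform on `ℤ/M`. -/
def fourierGate (M : ℕ) [NeZero M] : unitaryGroup (ZMod M) ℂ :=
  ⟨of fun y x => ((Real.sqrt M)⁻¹ : ℝ) * ZMod.stdAddChar (x * y), by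
    rw [mem_unitaryGroup_iff]
    ext y z
    have hM : (M : ℂ) ≠ 0 := Nat.cast_ne_zero.2 (NeZero.ne M)
    have hsq : (((Real.sqrt M)⁻¹ : ℝ) : ℂ) * (((Real.sqrt M)⁻¹ : ℝ) : ℂ) = (M : ℂ)⁻¹ := by
      rw [← Complex.ofReal_mul, ← mul_inv, Real.mul_self_sqrt (Nat.cast_nonneg M)]
      push_cast; rfl
    have h := AddChar.sum_mulShift (R' := ℂ) (y - z) (ZMod.isPrimitive_stdAddChar M)
    rw [ZMod.card] at h
    simp only [mul_apply, star_apply, of_apply, one_apply]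
    have h2 : ∀ x : ZMod M, (((Real.sqrt M)⁻¹ : ℝ) : ℂ) * ZMod.stdAddChar (x * y) *
        star ((((Real.sqrt M)⁻¹ : ℝ) : ℂ) * ZMod.stdAddChar (x * z))
          = (M : ℂ)⁻¹ * ZMod.stdAddChar (x * (y - z)) := by
      intro x
      rw [star_mul', RCLike.star_def, Complex.conj_ofReal,
        ← AddChar.map_neg_eq_conj, mul_sub, sub_eq_add_neg, AddChar.map_add_eq_mul, ← hsq]
      ring
    simp only [h2, ← Finset.mul_sum, h, sub_eq_zero]
    split_ifs <;> simp [hM]⟩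

theorem fourierGate_apply (y x : ZMod M) : (fourierGate M : Matrix (ZMod M) (ZMod M) ℂ) y x
    = ((Real.sqrt M)⁻¹ : ℝ) * ZMod.stdAddChar (x * y) := rfl

/-- The estimate of a probability that belongs to the phase `y / M`. -/
def phaseEstimate (y : ZMod M) : ℝ := (1 - (ZMod.stdAddChar y : ℂ).re) / 2

/-- Parseval on the counter, separately for each `r`. -/
theorem sum_stateNormSq_fourierGate (Φ : ZMod M → R → ℂ) :
    (∑ y, stateNormSq fun r => ∑ x, (fourierGate M : Matrix (ZMod M) (ZMod M) ℂ) y x * Φ x r)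
      = ∑ x, stateNormSq (Φ x) := by
  simp only [stateNormSq]
  rw [Finset.sum_comm, Finset.sum_comm (f := fun x r => ‖Φ x r‖ ^ 2)]
  refine Finset.sum_congr rfl fun r _ => ?_
  exact stateNormSq_mulVec (fourierGate M) fun x => Φ x r

/-- Multiplication by `phaseEstimate y - p` corresponds to a second difference before the Fourier
transform. -/
theorem phaseEstimate_sub_mul (Φ : ZMod M → ℂ) (p : ℝ) (y : ZMod M) :
    ((phaseEstimate y - p : ℝ) : ℂ) *
        ∑ x, (fourierGate M : Matrix (ZMod M) (ZMod M) ℂ) y x * Φ x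
      = ∑ x, (fourierGate M : Matrix (ZMod M) (ZMod M) ℂ) y x *
          (((2 - 4 * p) * Φ x - Φ (x - 1) - Φ (x + 1)) / 4) := by
  -- The cosine is the mean of two conjugate characters, and multiplication by either is a shift of
  -- the counter by one before the transform.
  have hre : ((phaseEstimate y : ℝ) : ℂ)
      = (2 - ZMod.stdAddChar y - ZMod.stdAddChar (-y)) / 4 := by
    have h := Complex.add_conj (ZMod.stdAddChar y : ℂ)
    rw [← AddChar.map_neg_eq_conj] at h
    rw [phaseEstimate]
    push_cast at h ⊢
    linear_combination (1 / 4 : ℂ) * h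
  have h1 : ∑ x, (fourierGate M : Matrix (ZMod M) (ZMod M) ℂ) y x * Φ (x - 1)
      = ZMod.stdAddChar y * ∑ x, (fourierGate M : Matrix (ZMod M) (ZMod M) ℂ) y x * Φ x := by
    rw [← Equiv.sum_comp (Equiv.addRight (1 : ZMod M)), Finset.mul_sum]
    refine Finset.sum_congr rfl fun x _ => ?_
    simp only [Equiv.coe_addRight, fourierGate_apply, add_mul, one_mul, AddChar.map_add_eq_mul,
      add_sub_cancel_right]
    ring
  have h2 : ∑ x, (fourierGate M : Matrix (ZMod M) (ZMod M) ℂ) y x * Φ (x + 1)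
      = ZMod.stdAddChar (-y) * ∑ x, (fourierGate M : Matrix (ZMod M) (ZMod M) ℂ) y x * Φ x := by
    rw [← Equiv.sum_comp (Equiv.subRight (1 : ZMod M)), Finset.mul_sum]
    refine Finset.sum_congr rfl fun x _ => ?_
    simp only [Equiv.subRight_apply, fourierGate_apply, sub_mul, one_mul, sub_eq_add_neg (x * y),
      AddChar.map_add_eq_mul, sub_add_cancel]
    ring
  have h3 : ∑ x, (fourierGate M : Matrix (ZMod M) (ZMod M) ℂ) y x *
      (((2 - 4 * p) * Φ x - Φ (x - 1) - Φ (x + 1)) / 4)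
        = ((2 - 4 * p) * ∑ x, (fourierGate M : Matrix (ZMod M) (ZMod M) ℂ) y x * Φ x
          - ∑ x, (fourierGate M : Matrix (ZMod M) (ZMod M) ℂ) y x * Φ (x - 1)
          - ∑ x, (fourierGate M : Matrix (ZMod M) (ZMod M) ℂ) y x * Φ (x + 1)) / 4 := by
    rw [Finset.mul_sum, ← Finset.sum_sub_distrib, ← Finset.sum_sub_distrib, Finset.sum_div]
    exact Finset.sum_congr rfl fun x _ => by ring
  rw [h3, h1, h2, Complex.ofReal_sub, hre]
  ring

theorem sum_stateNormSq_mul_phaseEstimate (Φ : ZMod M → R → ℂ) (p : ℝ) :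
    (∑ y, stateNormSq (fun r => ∑ x, (fourierGate M : Matrix (ZMod M) (ZMod M) ℂ) y x * Φ x r)
        * (phaseEstimate y - p) ^ 2)
      = ∑ x, stateNormSq fun r =>
          ((2 - 4 * p) * Φ x r - Φ (x - 1) r - Φ (x + 1) r) / 4 := by
  rw [← sum_stateNormSq_fourierGate]
  refine Finset.sum_congr rfl fun y _ => ?_
  simp only [← phaseEstimate_sub_mul (fun x => Φ x _)]
  rw [stateNormSq_const_mul, Complex.norm_real, Real.norm_eq_abs, sq_abs, mul_comm]

end Fourier

/-! ### The window -/

section Window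

/-- The amplitudes of the counter, up to normalisation. -/
def window (q t : ℕ) : ℝ := if t ≤ 4 * q then ((t : ℝ) * (4 * q - t)) ^ 2 else 0

/-- With `a = (s+1)(4q-(s+1)) ∈ [0, 4q²]` the second difference is `4a - 2(4q-2(s+1))² - 2`, at most
`32q² + 2` in absolute value. The double zeros of the window keep the order `q²` at its ends. -/
theorem window_second_difference (q s : ℕ) (hs : s < 4 * q) :
    (2 * window q (s + 1) - window q (s + 2) - window q s) ^ 2 ≤ (34 * (q : ℝ) ^ 2) ^ 2 := by
  have hq : (1 : ℝ) ≤ q := by exact_mod_cast (by omega : 1 ≤ q)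
  have hs' : (s : ℝ) + 1 ≤ 4 * q := by exact_mod_cast hs
  have hs0 : (0 : ℝ) ≤ s := Nat.cast_nonneg s
  rw [sq_le_sq, abs_of_nonneg (by positivity : (0 : ℝ) ≤ 34 * (q : ℝ) ^ 2), abs_le]
  simp only [window]
  rw [if_pos (by omega : s + 1 ≤ 4 * q), if_pos (by omega : s ≤ 4 * q)]
  have hN : (4 * q - 2 * (s + 1) : ℝ) ^ 2 ≤ 16 * q ^ 2 := by nlinarith
  have ha : 0 ≤ ((s : ℝ) + 1) * (4 * q - (s + 1)) := mul_nonneg (by linarith) (by linarith)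
  have ha' : ((s : ℝ) + 1) * (4 * q - (s + 1)) ≤ 4 * q ^ 2 := by
    nlinarith [sq_nonneg (4 * q - 2 * (s + 1) : ℝ)]
  split_ifs with h
  · push_cast
    have key : 2 * (((s : ℝ) + 1) * (4 * q - (s + 1))) ^ 2 - (((s : ℝ) + 2) * (4 * q - (s + 2))) ^ 2
        - ((s : ℝ) * (4 * q - s)) ^ 2
          = 4 * (((s : ℝ) + 1) * (4 * q - (s + 1))) - 2 * (4 * q - 2 * (s + 1) : ℝ) ^ 2 - 2 := by
      ring
    rw [key]
    constructor <;> nlinarith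
  · have : (s : ℝ) + 1 = 4 * q := by exact_mod_cast (by omega : s + 1 = 4 * q)
    have hs2 : (s : ℝ) = 4 * q - 1 := by linarith
    push_cast
    rw [hs2]
    constructor <;> nlinarith

/-- As a difference of two squares it factors into terms of size at most `8q` and `8q²`. -/
theorem window_difference (q s : ℕ) (hs : s < 4 * q) :
    (window q (s + 2) - window q s) ^ 2 ≤ (64 * (q : ℝ) ^ 3) ^ 2 := by
  have hq : (1 : ℝ) ≤ q := by exact_mod_cast (by omega : 1 ≤ q)
  have hs' : (s : ℝ) + 1 ≤ 4 * q := by exact_mod_cast hs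
  have hs0 : (0 : ℝ) ≤ s := Nat.cast_nonneg s
  simp only [window]
  rw [if_pos (by omega : s ≤ 4 * q)]
  split_ifs with h
  · have hs2 : (s : ℝ) + 2 ≤ 4 * q := by exact_mod_cast h
    push_cast
    have key : (((s : ℝ) + 2) * (4 * q - (s + 2))) ^ 2 - ((s : ℝ) * (4 * q - s)) ^ 2
        = (4 * (2 * q - (s + 1))) * (((s : ℝ) + 2) * (4 * q - (s + 2)) + s * (4 * q - s)) := by
      ring
    rw [key, mul_pow]
    have h1 : (4 * (2 * q - (s + 1)) : ℝ) ^ 2 ≤ (8 * q) ^ 2 := by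
      apply sq_le_sq'
      · linarith
      · linarith
    have h2 : (((s : ℝ) + 2) * (4 * q - (s + 2)) + s * (4 * q - s)) ^ 2 ≤ (8 * q ^ 2) ^ 2 := by
      apply pow_le_pow_left₀
      · exact add_nonneg (mul_nonneg (by linarith) (by linarith))
          (mul_nonneg hs0 (by linarith))
      · nlinarith [sq_nonneg (2 * q - (s + 2) : ℝ), sq_nonneg (2 * q - s : ℝ)]
    calc _ ≤ (8 * q : ℝ) ^ 2 * (8 * q ^ 2) ^ 2 := mul_le_mul h1 h2 (sq_nonneg _) (sq_nonneg _)
      _ = _ := by ring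
  · have : (s : ℝ) + 1 = 4 * q := by exact_mod_cast (by omega : s + 1 = 4 * q)
    have hs2 : (s : ℝ) = 4 * q - 1 := by linarith
    rw [hs2, zero_sub, neg_sq]
    apply pow_le_pow_left₀ (by positivity)
    have h3 : (q : ℝ) ^ 2 ≤ q ^ 3 := by nlinarith [sq_nonneg (q : ℝ)]
    nlinarith

theorem window_zero (q : ℕ) : window q 0 = 0 := by simp [window]

theorem window_one_sq (q : ℕ) : window q 1 ^ 2 ≤ (34 * (q : ℝ) ^ 2) ^ 2 := by
  rcases Nat.eq_zero_or_pos q with rfl | hq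
  · simp [window]
  have hq1 : (1 : ℝ) ≤ q := by exact_mod_cast hq
  rw [window, if_pos (by omega)]
  apply pow_le_pow_left₀ (by positivity)
  push_cast
  nlinarith

theorem window_last (q : ℕ) : window q (4 * q) = 0 := by simp [window]

/-- The square of the norm of the window. -/
def windowNormSq (q : ℕ) : ℝ := ∑ x : ZMod (4 * q + 1), window q x.val ^ 2

/-- For `q ≤ t < 2q` both `t` and `4q - t` are at least `q`, so `q` of the terms are at least `q⁸`.
-/
theorem le_windowNormSq (q : ℕ) : (q : ℝ) ^ 9 ≤ windowNormSq q := by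
  have h : windowNormSq q = ∑ t ∈ Finset.range (4 * q + 1), window q t ^ 2 :=
    Fin.sum_univ_eq_sum_range (fun t => window q t ^ 2) (4 * q + 1)
  rw [h]
  calc (q : ℝ) ^ 9 = ∑ t ∈ Finset.Ico q (2 * q), (q : ℝ) ^ 8 := by
        rw [Finset.sum_const, Nat.card_Ico, nsmul_eq_mul]
        have : 2 * q - q = q := by omega
        rw [this]; ring
    _ ≤ ∑ t ∈ Finset.Ico q (2 * q), window q t ^ 2 := by
        refine Finset.sum_le_sum fun t ht => ?_
        rw [Finset.mem_Ico] at ht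
        have h1 : (q : ℝ) ≤ t := by exact_mod_cast ht.1
        have h2 : (t : ℝ) ≤ 2 * q := by exact_mod_cast ht.2.le
        have hq : (0 : ℝ) ≤ q := Nat.cast_nonneg q
        rw [window, if_pos (by omega)]
        have h3 : (q : ℝ) ≤ 4 * q - t := by linarith
        calc (q : ℝ) ^ 8 = (((q : ℝ) * q) ^ 2) ^ 2 := by ring
          _ ≤ (((t : ℝ) * (4 * q - t)) ^ 2) ^ 2 := by gcongr
    _ ≤ _ := Finset.sum_le_sum_of_subset_of_nonneg
        (fun t ht => by simp only [Finset.mem_Ico, Finset.mem_range] at *; omega)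
        fun _ _ _ => sq_nonneg _

variable {R : Type} [Fintype R]

theorem window_orbit_difference_le {v : ℕ → R → ℂ} {p : ℝ} (hp : 0 ≤ p) (hp1 : p ≤ 1)
    (hv : ∀ t, stateNormSq (v t) = 1)
    (hrec : ∀ t r, v (t + 2) r + v t r = (2 - 4 * p) * v (t + 1) r) (q : ℕ)
    {Φ : ZMod (4 * q + 1) → R → ℂ} (hΦ : ∀ x r, Φ x r = window q x.val * v x.val r)
    (x : ZMod (4 * q + 1)) :
    stateNormSq (fun r => ((2 - 4 * p) * Φ x r - Φ (x - 1) r - Φ (x + 1) r) / 4)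
      ≤ 1024 * ((q : ℝ) ^ 4 + p * q ^ 6) := by
  have hq0 : (0 : ℝ) ≤ q := Nat.cast_nonneg q
  have hlt := ZMod.val_lt x
  have hnext : ∀ r, Φ (x + 1) r = window q (x.val + 1) * v (x.val + 1) r := by
    intro r
    rw [hΦ]
    rcases Nat.lt_or_ge (x.val + 1) (4 * q + 1) with h | h
    · have : (x + 1).val = x.val + 1 := by
        rw [ZMod.val_add, ZMod.val_one'' (by omega), Nat.mod_eq_of_lt h]
      rw [this]
    · have h' : x.val = 4 * q := by omega
      have : x + 1 = 0 := by
        have := ZMod.natCast_zmod_val x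
        rw [← this, h']
        exact_mod_cast ZMod.natCast_self (4 * q + 1)
      -- Wrap-around is harmless: `x + 1 = 0` has weight `0`, and the cut-off in `window` gives the
      -- index `4q + 1` weight `0` as well.
      rw [this, ZMod.val_zero, window_zero, window, if_neg (by omega)]
      simp
  rcases Nat.eq_zero_or_pos x.val with h0 | h0
  -- The orbit has no term before `v 0`, but the cyclic predecessor `4q` of `0` has weight `0`, and
  -- only the term with `v 1` remains.
  · have hx : x = 0 := (ZMod.val_eq_zero x).1 h0
    have hfun : (fun r => ((2 - 4 * p) * Φ x r - Φ (x - 1) r - Φ (x + 1) r) / 4)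
        = fun r => ((-window q 1 / 4 : ℝ) : ℂ) * v 1 r := by
      funext r
      rw [hnext, h0, hΦ x, h0, window_zero, hx, zero_sub, hΦ]
      have : (-1 : ZMod (4 * q + 1)).val = 4 * q := ZMod.val_neg_one (4 * q)
      rw [this, window_last]
      push_cast; ring
    rw [hfun, stateNormSq_const_mul, hv, Complex.norm_real, Real.norm_eq_abs, sq_abs, mul_one]
    have := window_one_sq q
    have h6 : 0 ≤ p * (q : ℝ) ^ 6 := by positivity
    have h4 : 0 ≤ (q : ℝ) ^ 4 := by positivity
    nlinarith
  · obtain ⟨s, hs⟩ : ∃ s, x.val = s + 1 := ⟨x.val - 1, by omega⟩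
    have hprev : (x - 1).val = s := by
      have : x - 1 = ((s : ℕ) : ZMod (4 * q + 1)) := by
        have := ZMod.natCast_zmod_val x
        rw [← this, hs]; push_cast; ring
      rw [this, ZMod.val_natCast, Nat.mod_eq_of_lt (by omega)]
    -- The recurrence eliminates `v (s + 1)`, so first differences of the window become the
    -- coefficients.
    have hfun : (fun r => ((2 - 4 * p) * Φ x r - Φ (x - 1) r - Φ (x + 1) r) / 4)
        = fun r => (((window q (s + 1) - window q (s + 2)) / 4 : ℝ) : ℂ) * v (s + 2) r
          + (((window q (s + 1) - window q s) / 4 : ℝ) : ℂ) * v s r := by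
      funext r
      rw [hnext, hΦ x, hΦ (x - 1), hprev, hs]
      push_cast
      linear_combination (-(window q (s + 1)) / 4 : ℂ) * hrec s r
    rw [hfun]
    -- Up to sign, `α + β` and `α - β` are a quarter of the differences bounded in `h1` and `h2`;
    -- the constant is `4 · 64² / 16 = 1024`.
    refine (stateNormSq_combination_le hp hp1 hv hrec s _ _).trans ?_
    have h1 := window_second_difference q s (by omega)
    have h2 := window_difference q s (by omega)
    have h3 := mul_le_mul_of_nonneg_left h2 hp
    have h6 : 0 ≤ p * (q : ℝ) ^ 6 := by positivity
    have h4 : 0 ≤ (q : ℝ) ^ 4 := by positivity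
    nlinarith

end Window

/-! ### Amplitude estimation -/

theorem single_eq_pack {K R X : Type} [DecidableEq K] [DecidableEq R] [DecidableEq X]
    (e : K ≃ R × X) (r₀ : R) (x₀ : X) :
    (Pi.single (e.symm (r₀, x₀)) 1 : K → ℂ)
      = pack e fun x r => (Pi.single x₀ 1 : X → ℂ) x * (Pi.single r₀ 1 : R → ℂ) r := by
  funext k
  simp only [pack, Pi.single_apply, Equiv.eq_symm_apply, Prod.ext_iff, ite_and, mul_ite, mul_one,
    mul_zero]

section AmplitudeEstimation

variable {K R X Q : Type} [Fintype K] [DecidableEq K] [Fintype R] [DecidableEq R]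
  [Fintype X] [DecidableEq X]

/-- A unitary on `R` acts on `R × X`. -/
def liftGate (e : K ≃ R × X) : unitaryGroup R ℂ →* unitaryGroup K ℂ where
  toFun V := controlledGate e fun _ => V
  map_one' := by
    apply Subtype.ext
    have : (fun _ : X => (1 : Matrix R R ℂ)) = 1 := rfl
    simp [controlledGate, this]
  map_mul' V W := by
    apply Subtype.ext
    simp only [controlledGate, UnitaryGroup.mul_val, submatrix_mul_equiv, ← blockDiagonal_mul]

theorem liftGate_mulVec_pack (e : K ≃ R × X) (V : unitaryGroup R ℂ) (Φ : X → R → ℂ) :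
    (liftGate e V : Matrix K K ℂ) *ᵥ pack e Φ = pack e fun x => (V : Matrix R R ℂ) *ᵥ Φ x :=
  controlledGate_mulVec_pack e (fun _ => V) Φ

variable (inv : Q → Q) (c : Circuit R Q) (r₀ : R) (χ : R → Bool)

/-- `t` conditional applications of the Grover operator: the `s`-th one takes place where the counter
exceeds `s`. -/
def groverRounds {M : ℕ} [NeZero M] (e : K ≃ R × ZMod M) : ℕ → Circuit K Q
  | 0 => []
  | t + 1 => groverRounds e t ++
      ([.inl (controlledGate e fun x => if t < x.val then signGate χ else 1)] ++
      ((c.inverse inv).mapGates (liftGate e) ++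
      ([.inl (controlledGate e fun x => if t < x.val then signGate fun r => decide (r ≠ r₀) else 1)]
        ++ c.mapGates (liftGate e))))

/-- Prepare the window on the counter and the state, apply a power of the Grover operator that the
counter controls, and transform the counter. -/
def amplitudeCircuit (q : ℕ) (e : K ≃ R × ZMod (4 * q + 1)) : Circuit K Q :=
  [.inl (controlledGate (e.trans (Equiv.prodComm R _)) fun _ =>
      prepareGate 0 fun x => ((window q x.val / Real.sqrt (windowNormSq q) : ℝ) : ℂ))] ++
    (c.mapGates (liftGate e) ++ (groverRounds inv c r₀ χ e (4 * q + 1) ++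
      [.inl (controlledGate (e.trans (Equiv.prodComm R _)) fun _ => fourierGate (4 * q + 1))]))

variable {inv c r₀ χ}

theorem count_groverRounds {M : ℕ} [NeZero M] {T : Q → Bool} (hT : ∀ q, T (inv q) = T q)
    (e : K ≃ R × ZMod M) (t : ℕ) :
    (groverRounds inv c r₀ χ e t).count T = t * (2 * c.count T) := by
  induction t with
  | zero => simp [groverRounds, Circuit.count]
  | succ t ih =>
    rw [groverRounds]
    simp only [Circuit.count_append, ih, Circuit.count_mapGates, Circuit.count_inverse hT,
      Circuit.count]
    ring

theorem count_amplitudeCircuit {T : Q → Bool} (hT : ∀ q, T (inv q) = T q) (q : ℕ)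
    (e : K ≃ R × ZMod (4 * q + 1)) :
    (amplitudeCircuit inv c r₀ χ q e).count T = (8 * q + 3) * c.count T := by
  rw [amplitudeCircuit]
  simp only [Circuit.count_append, count_groverRounds hT, Circuit.count_mapGates, Circuit.count]
  ring

variable {N : Q → unitaryGroup R ℂ}

theorem eval_append_mulVec (N : Q → unitaryGroup K ℂ) (c d : Circuit K Q) (ψ : K → ℂ) :
    (Circuit.eval N (c ++ d) : Matrix K K ℂ) *ᵥ ψ
      = (Circuit.eval N d : Matrix K K ℂ) *ᵥ ((Circuit.eval N c : Matrix K K ℂ) *ᵥ ψ) := by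
  rw [Circuit.eval_append, UnitaryGroup.mul_val, mulVec_mulVec]

theorem eval_gate (N : Q → unitaryGroup K ℂ) (V : unitaryGroup K ℂ) :
    Circuit.eval N [.inl V] = V := by simp [Circuit.eval]

/-- The black boxes cannot be called conditionally, so every round calls `c` and its inverse, and
only the two sign gates depend on the counter. Where these are off, the calls cancel. -/
theorem groverRounds_mulVec {M : ℕ} [NeZero M] (hinv : ∀ q, N (inv q) = (N q)⁻¹)
    (e : K ≃ R × ZMod M) (Φ : ZMod M → R → ℂ) (t : ℕ) :
    (Circuit.eval (fun q => liftGate e (N q)) (groverRounds inv c r₀ χ e t) : Matrix K K ℂ) *ᵥ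
        pack e Φ = pack e fun x => orbit (groverGate (c.eval N) r₀ χ) (Φ x) (min t x.val) := by
  induction t with
  | zero => simp [groverRounds, Circuit.eval, orbit]
  | succ t ih =>
    rw [groverRounds]
    simp only [eval_append_mulVec, ih, eval_gate, controlledGate_mulVec_pack,
      Circuit.eval_mapGates (N' := fun q => liftGate e (N q)) (liftGate e) (fun _ => rfl),
      liftGate_mulVec_pack, Circuit.eval_inverse hinv]
    congr 1
    funext x
    split_ifs with h
    · rw [min_eq_left h.le, min_eq_left (Nat.succ_le_of_lt h), orbit_succ]
      simp only [groverGate, UnitaryGroup.mul_val, mulVec_mulVec, mul_assoc]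
    · have h' : x.val ≤ t := not_lt.1 h
      rw [min_eq_right h', min_eq_right (h'.trans (Nat.le_succ t))]
      have := unitary_inv_mulVec_mulVec (c.eval N)⁻¹
      simp only [inv_inv] at this
      simp only [UnitaryGroup.one_val, one_mulVec, this]

theorem amplitudeCircuit_mulVec (hinv : ∀ q, N (inv q) = (N q)⁻¹) {q : ℕ} (hq : 1 ≤ q)
    (e : K ≃ R × ZMod (4 * q + 1)) {ψ : R → ℂ}
    (hψ : (c.eval N : Matrix R R ℂ) *ᵥ Pi.single r₀ 1 = ψ) :
    (Circuit.eval (fun q => liftGate e (N q)) (amplitudeCircuit inv c r₀ χ q e) : Matrix K K ℂ) *ᵥ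
        Pi.single (e.symm (r₀, 0)) 1
      = pack e fun y r => ∑ x, (fourierGate (4 * q + 1) : Matrix (ZMod (4 * q + 1)) (ZMod (4 * q + 1)) ℂ) y x *
          (((window q x.val / Real.sqrt (windowNormSq q) : ℝ) : ℂ)
            * orbit (groverGate (c.eval N) r₀ χ) ψ x.val r) := by
  have hW : 0 < windowNormSq q :=
    lt_of_lt_of_le (by positivity) (le_windowNormSq q)
  have hw : stateNormSq (fun x : ZMod (4 * q + 1) =>
      ((window q x.val / Real.sqrt (windowNormSq q) : ℝ) : ℂ)) = 1 := by
    simp only [stateNormSq, Complex.norm_real, Real.norm_eq_abs, sq_abs, div_pow,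
      Real.sq_sqrt hW.le, ← Finset.sum_div]
    exact div_self hW.ne'
  rw [amplitudeCircuit]
  simp only [eval_append_mulVec, eval_gate, single_eq_pack, controlledGate_swap_mulVec_pack,
    Circuit.eval_mapGates (N' := fun q => liftGate e (N q)) (liftGate e) (fun _ => rfl),
    liftGate_mulVec_pack, groverRounds_mulVec hinv]
  congr 1
  funext y r
  refine Finset.sum_congr rfl fun x _ => ?_
  congr 1
  -- There are `4q + 1` rounds, more than any counter value, so the value `x` receives exactly `x`
  -- Grover steps.
  rw [min_eq_right (ZMod.val_lt x).le]
  have h1 : (fun r => ∑ z, (prepareGate (0 : ZMod (4 * q + 1)) (fun x : ZMod (4 * q + 1) =>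
      ((window q x.val / Real.sqrt (windowNormSq q) : ℝ) : ℂ)) : Matrix (ZMod (4 * q + 1)) (ZMod (4 * q + 1)) ℂ) x z *
        ((Pi.single 0 1 : ZMod (4 * q + 1) → ℂ) z * (Pi.single r₀ 1 : R → ℂ) r))
      = ((window q x.val / Real.sqrt (windowNormSq q) : ℝ) : ℂ) • (Pi.single r₀ 1 : R → ℂ) := by
    funext r
    rw [Finset.sum_eq_single 0 (by simp +contextual) (by simp), prepareGate_apply hw]
    simp
  rw [h1, mulVec_smul, hψ, orbit, orbit, mulVec_smul]
  simp

/-- The mean square error of amplitude estimation with about `4 q` Grover operators. -/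
theorem amplitudeCircuit_sq_error (hinv : ∀ q, N (inv q) = (N q)⁻¹) {q : ℕ} (hq : 1 ≤ q)
    (e : K ≃ R × ZMod (4 * q + 1)) {ψ : R → ℂ}
    (hψ : (c.eval N : Matrix R R ℂ) *ᵥ Pi.single r₀ 1 = ψ) :
    (∑ k, ‖((Circuit.eval (fun q => liftGate e (N q)) (amplitudeCircuit inv c r₀ χ q e) :
        Matrix K K ℂ) *ᵥ Pi.single (e.symm (r₀, 0)) 1) k‖ ^ 2 *
          (phaseEstimate (e k).2 - markedProb χ ψ) ^ 2)
      ≤ 5120 * (markedProb χ ψ / q ^ 2 + 1 / q ^ 4) := by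
  set p := markedProb χ ψ with hp
  have hn : stateNormSq ψ = 1 := by rw [← hψ, stateNormSq_mulVec, stateNormSq_single]
  have hp0 : 0 ≤ p := markedProb_nonneg χ ψ
  have hp1 : p ≤ 1 := hn ▸ markedProb_le χ ψ
  have hq1 : (1 : ℝ) ≤ q := by exact_mod_cast hq
  have hq0 : (0 : ℝ) < q := by linarith
  have hW9 := le_windowNormSq q
  have hW : 0 < windowNormSq q := lt_of_lt_of_le (by positivity) hW9
  rw [amplitudeCircuit_mulVec hinv hq e hψ, sum_pack e _ fun y => (phaseEstimate y - p) ^ 2]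
  rw [sum_stateNormSq_mul_phaseEstimate]
  set v := orbit (groverGate (c.eval N) r₀ χ) ψ
  set Φ : ZMod (4 * q + 1) → R → ℂ := fun x r => window q x.val * v x.val r with hΦ
  have hterm : ∀ x : ZMod (4 * q + 1), stateNormSq (fun r => ((2 - 4 * (p : ℂ)) *
      (((window q x.val / Real.sqrt (windowNormSq q) : ℝ) : ℂ) * v x.val r)
      - ((window q (x - 1).val / Real.sqrt (windowNormSq q) : ℝ) : ℂ) * v (x - 1).val r
      - ((window q (x + 1).val / Real.sqrt (windowNormSq q) : ℝ) : ℂ) * v (x + 1).val r) / 4)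
        ≤ 1024 * ((q : ℝ) ^ 4 + p * q ^ 6) / windowNormSq q := by
    intro x
    have h1 := window_orbit_difference_le hp0 hp1 (stateNormSq_orbit hn)
      (orbit_grover_recurrence hψ χ) q (Φ := Φ) (fun _ _ => rfl) x
    have h2 := stateNormSq_const_mul (((Real.sqrt (windowNormSq q))⁻¹ : ℝ) : ℂ)
      (fun r => ((2 - 4 * (p : ℂ)) * Φ x r - Φ (x - 1) r - Φ (x + 1) r) / 4)
    rw [Complex.norm_real, Real.norm_eq_abs, sq_abs, inv_pow, Real.sq_sqrt hW.le] at h2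
    calc _ = (windowNormSq q)⁻¹ * stateNormSq
          (fun r => ((2 - 4 * (p : ℂ)) * Φ x r - Φ (x - 1) r - Φ (x + 1) r) / 4) := by
          rw [← h2]
          congr 1
          funext r
          simp only [hΦ]
          push_cast
          ring
      _ ≤ (windowNormSq q)⁻¹ * (1024 * ((q : ℝ) ^ 4 + p * q ^ 6)) := by gcongr
      _ = _ := by ring
  refine (Finset.sum_le_sum fun x _ => hterm x).trans ?_
  rw [Finset.sum_const, Finset.card_univ, ZMod.card, nsmul_eq_mul]
  push_cast
  -- At most `5q` terms, divided by a squared norm of at least `q⁹`; hence `5 · 1024 = 5120`.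
  calc (4 * (q : ℝ) + 1) * (1024 * ((q : ℝ) ^ 4 + p * q ^ 6) / windowNormSq q)
      ≤ (5 * q) * (1024 * ((q : ℝ) ^ 4 + p * q ^ 6) / q ^ 9) := by
        gcongr
        linarith
    _ = _ := by field_simp; ring

end AmplitudeEstimation

/-! ### Circuits that sample from Gibbs distributions -/

section GibbsCircuits

theorem unitary_ext_mulVec {K : Type} [Fintype K] [DecidableEq K] {V W : unitaryGroup K ℂ}
    (h : ∀ ψ : K → ℂ, (V : Matrix K K ℂ) *ᵥ ψ = (W : Matrix K K ℂ) *ᵥ ψ) : V = W :=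
  Subtype.ext (Matrix.mulVec_injective (funext h))

theorem permutationGate_inv {K : Type} [Fintype K] [DecidableEq K] (σ : Equiv.Perm K) :
    permutationGate σ⁻¹ = (permutationGate σ)⁻¹ := by
  refine eq_inv_of_mul_eq_one_left (unitary_ext_mulVec fun ψ => ?_)
  funext k
  rw [UnitaryGroup.mul_val, ← mulVec_mulVec, permutationGate_mulVec, permutationGate_mulVec]
  simp

variable {S Ω X ι : Type} {n : ℕ} [Fintype S] [DecidableEq S] [Fintype Ω] [DecidableEq Ω]
  [Fintype X] [DecidableEq X]

/-- The part of the memory without the counter: the flag is all of the workspace that is left. -/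
abbrev GibbsWork (S Ω : Type) (n : ℕ) : Type := GibbsMemory S Ω n Bool

/-- Separate the counter from the rest of the memory. -/
def counterEquiv (S Ω : Type) (n : ℕ) (X : Type) :
    GibbsMemory S Ω n (Bool × X) ≃ GibbsWork S Ω n × X where
  toFun k := ((k.1, k.2.1, k.2.2.1, k.2.2.2.1), k.2.2.2.2)
  invFun k := (k.1.1, k.1.2.1, k.1.2.2.1, k.1.2.2.2, k.2)
  left_inv _ := rfl
  right_inv _ := rfl

/-- Separate the configuration from the rest of the memory. -/
def configurationEquiv (S Ω : Type) (n : ℕ) :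
    GibbsWork S Ω n ≃ Ω × (S × Fin (n + 1) × Bool) where
  toFun k := (k.2.1, k.1, k.2.2)
  invFun k := (k.2.1, k.1, k.2.2)
  left_inv _ := rfl
  right_inv _ := rfl

/-- Separate the flag from the rest of the memory. -/
def flagEquiv (S Ω : Type) (n : ℕ) : GibbsWork S Ω n ≃ Bool × (S × Ω × Fin (n + 1)) where
  toFun k := (k.2.2.2, k.1, k.2.1, k.2.2.1)
  invFun k := (k.2.1, k.2.2.1, k.2.2.2, k.1)
  left_inv _ := rfl
  right_inv _ := rfl

/-- Subtract the energy of the configuration from the energy register. -/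
def energyShift (S : Type) (H : Ω → Fin (n + 1)) : Equiv.Perm (GibbsWork S Ω n) where
  toFun k := (k.1, k.2.1, k.2.2.1 - H k.2.1, k.2.2.2)
  invFun k := (k.1, k.2.1, k.2.2.1 + H k.2.1, k.2.2.2)
  left_inv k := by simp
  right_inv k := by simp

/-- The unitaries that the black boxes implement. -/
def gibbsGate (H : Ω → Fin (n + 1)) (U : ι → unitaryGroup S ℂ) :
    GibbsQuery ι → unitaryGroup (GibbsWork S Ω n) ℂ
  | .sample i => liftGate (Equiv.refl _) (U i)
  | .sampleInv i => liftGate (Equiv.refl _) (U i)⁻¹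
  -- A permutation gate composes `ψ` with the permutation, so subtraction in `energyShift` is
  -- addition on basis states.
  | .energy => permutationGate (energyShift S H)
  | .energyInv => permutationGate (energyShift S H)⁻¹

theorem gibbsGate_mulVec (H : Ω → Fin (n + 1)) (U : ι → unitaryGroup S ℂ) (q : GibbsQuery ι)
    (ψ : GibbsWork S Ω n → ℂ) :
    (gibbsGate H U q : Matrix (GibbsWork S Ω n) (GibbsWork S Ω n) ℂ) *ᵥ ψ
      = gibbsOracle H U q ψ := by
  cases q <;> funext k
  · exact controlledGate_mulVec _ _ _ _
  · exact controlledGate_mulVec _ _ _ _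
  · exact permutationGate_mulVec _ _ _
  · exact permutationGate_mulVec _ _ _

theorem gibbsOracle_eq_liftGate (H : Ω → Fin (n + 1)) (U : ι → unitaryGroup S ℂ)
    (q : GibbsQuery ι) (ψ : GibbsMemory S Ω n (Bool × X) → ℂ) :
    gibbsOracle H U q ψ = (liftGate (counterEquiv S Ω n X) (gibbsGate H U q) :
      Matrix (GibbsMemory S Ω n (Bool × X)) (GibbsMemory S Ω n (Bool × X)) ℂ) *ᵥ ψ := by
  have hψ : ψ = pack (counterEquiv S Ω n X) fun x r => ψ ((counterEquiv S Ω n X).symm (r, x)) := by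
    funext k
    simp [pack]
  conv_rhs => rw [hψ, liftGate_mulVec_pack]
  simp only [gibbsGate_mulVec]
  cases q <;> rfl

namespace GibbsQuery

/-- The black box for the inverse. -/
def inverse : GibbsQuery ι → GibbsQuery ι
  | sample i => sampleInv i
  | sampleInv i => sample i
  | energy => energyInv
  | energyInv => energy

theorem isSample_inverse (q : GibbsQuery ι) : q.inverse.isSample = q.isSample := by
  cases q <;> rfl

theorem isEnergy_inverse (q : GibbsQuery ι) : q.inverse.isEnergy = q.isEnergy := by
  cases q <;> rfl

end GibbsQuery

theorem gibbsGate_inverse (H : Ω → Fin (n + 1)) (U : ι → unitaryGroup S ℂ) (q : GibbsQuery ι) :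
    gibbsGate H U q.inverse = (gibbsGate H U q)⁻¹ := by
  cases q <;> simp [gibbsGate, GibbsQuery.inverse, permutationGate_inv]

/-- The amplitudes of a flag that is set with probability `v`. -/
def flagAmplitude (v : ℝ) (b : Bool) : ℂ := (if b then Real.sqrt v else Real.sqrt (1 - v) : ℝ)

theorem norm_flagAmplitude_sq {v : ℝ} (h0 : 0 ≤ v) (h1 : v ≤ 1) (b : Bool) :
    ‖flagAmplitude v b‖ ^ 2 = if b then v else 1 - v := by
  rw [flagAmplitude, Complex.norm_real, Real.norm_eq_abs, sq_abs]
  cases b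
  · simpa using Real.sq_sqrt (sub_nonneg.2 h1)
  · simpa using Real.sq_sqrt h0

theorem stateNormSq_flagAmplitude {v : ℝ} (h0 : 0 ≤ v) (h1 : v ≤ 1) :
    stateNormSq (flagAmplitude v) = 1 := by
  simp [stateNormSq, norm_flagAmplitude_sq h0 h1]

/-- Run `c`, evaluate the energy, and set the flag with probability `v h` if the energy is `h`. -/
def flagCircuit (c : Circuit (GibbsWork S Ω n) (GibbsQuery ι)) (v : Fin (n + 1) → ℝ) :
    Circuit (GibbsWork S Ω n) (GibbsQuery ι) :=
  c ++ [.inr .energy, .inl (controlledGate (flagEquiv S Ω n) fun k =>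
    prepareGate false (flagAmplitude (v k.2.2)))]

/-- The state after `c` lives on the first two registers, and a measurement of the configuration has
the distribution `p`. -/
def PreparesDistribution (c : Circuit (GibbsWork S Ω n) (GibbsQuery ι)) (H : Ω → Fin (n + 1))
    (U : ι → unitaryGroup S ℂ) (r₀ : GibbsWork S Ω n) (p : Ω → ℝ) : Prop :=
  ∃ χ : S → Ω → ℂ, ((c.eval (gibbsGate H U) : unitaryGroup (GibbsWork S Ω n) ℂ) :
      Matrix (GibbsWork S Ω n) (GibbsWork S Ω n) ℂ) *ᵥ Pi.single r₀ 1
        = (fun k => if k.2.2 = (0, false) then χ k.1 k.2.1 else 0) ∧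
    ∀ x, ∑ s, ‖χ s x‖ ^ 2 = p x

/-- Only the joint law of energy and flag is ever used: with `v = 0` it gives the sampled energy,
with `g` the indicator of the flag the amplitude to be estimated. Hence the other registers need not
be cleared. -/
theorem PreparesDistribution.sum_flagCircuit {c : Circuit (GibbsWork S Ω n) (GibbsQuery ι)}
    {H : Ω → Fin (n + 1)} {U : ι → unitaryGroup S ℂ} {r₀ : GibbsWork S Ω n} {p : Ω → ℝ}
    (h : PreparesDistribution c H U r₀ p) {v : Fin (n + 1) → ℝ} (h0 : ∀ j, 0 ≤ v j)
    (h1 : ∀ j, v j ≤ 1) (g : Fin (n + 1) → Bool → ℝ) :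
    (∑ k, ‖((((flagCircuit c v).eval (gibbsGate H U) : unitaryGroup (GibbsWork S Ω n) ℂ) :
      Matrix (GibbsWork S Ω n) (GibbsWork S Ω n) ℂ) *ᵥ Pi.single r₀ 1) k‖ ^ 2
        * g k.2.2.1 k.2.2.2)
      = ∑ x, p x * ((1 - v (H x)) * g (H x) false + v (H x) * g (H x) true) := by
  obtain ⟨χ, hχ, hp⟩ := h
  have hstate : (((flagCircuit c v).eval (gibbsGate H U) : unitaryGroup (GibbsWork S Ω n) ℂ) :
      Matrix (GibbsWork S Ω n) (GibbsWork S Ω n) ℂ) *ᵥ Pi.single r₀ 1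
        = fun k => if k.2.2.1 = H k.2.1 then χ k.1 k.2.1 * flagAmplitude (v k.2.2.1) k.2.2.2
          else 0 := by
    rw [flagCircuit, eval_append_mulVec, hχ]
    simp only [Circuit.eval, one_mul, UnitaryGroup.mul_val, ← mulVec_mulVec, gibbsGate_mulVec]
    funext k
    obtain ⟨s, x, j, b⟩ := k
    rw [controlledGate_mulVec]
    simp only [flagEquiv, Equiv.coe_fn_mk, Equiv.coe_fn_symm_mk, gibbsOracle, Fintype.sum_bool,
      Prod.mk.injEq, sub_eq_zero, prepareGate_apply (stateNormSq_flagAmplitude (h0 j) (h1 j))]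
    split_ifs <;> simp_all [mul_comm]
  rw [hstate]
  have : ∀ k : GibbsWork S Ω n, ‖if k.2.2.1 = H k.2.1 then
      χ k.1 k.2.1 * flagAmplitude (v k.2.2.1) k.2.2.2 else 0‖ ^ 2 * g k.2.2.1 k.2.2.2
      = if k.2.2.1 = H k.2.1 then ‖χ k.1 k.2.1‖ ^ 2 *
        ((if k.2.2.2 then v k.2.2.1 else 1 - v k.2.2.1) * g k.2.2.1 k.2.2.2) else 0 := by
    intro k
    split_ifs with h2 h3 <;>
      simp_all [mul_pow, norm_flagAmplitude_sq, mul_assoc]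
  simp only [this]
  rw [Fintype.sum_prod_type, Finset.sum_congr rfl fun s _ => Fintype.sum_prod_type _,
    Finset.sum_comm]
  refine Finset.sum_congr rfl fun x _ => ?_
  rw [← hp, Finset.sum_mul]
  refine Finset.sum_congr rfl fun s _ => ?_
  rw [Fintype.sum_prod_type, Finset.sum_eq_single (H x)]
  · simp; ring
  · intro j _ hj; simp [hj]
  · simp

/-- Copy `φ s` to the configuration register, if that contains `x₀`. -/
def copyPerm (φ : S → Ω) (x₀ : Ω) (n : ℕ) : Equiv.Perm (GibbsWork S Ω n) where
  toFun k := (k.1, Equiv.swap x₀ (φ k.1) k.2.1, k.2.2)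
  invFun k := (k.1, Equiv.swap x₀ (φ k.1) k.2.1, k.2.2)
  left_inv k := by simp
  right_inv k := by simp

/-- The uniform distribution on the configurations. -/
def uniformCircuit (S : Type) [Fintype S] [DecidableEq S] (n : ℕ) (ι : Type) (x₀ : Ω) :
    Circuit (GibbsWork S Ω n) (GibbsQuery ι) :=
  [.inl (liftGate (configurationEquiv S Ω n)
    (prepareGate x₀ fun _ => (((Real.sqrt (Fintype.card Ω))⁻¹ : ℝ) : ℂ)))]

/-- The distribution of a sampler. -/
def samplerCircuit (φ : S → Ω) (x₀ : Ω) (n : ℕ) (i : ι) :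
    Circuit (GibbsWork S Ω n) (GibbsQuery ι) :=
  [.inr (.sample i), .inl (permutationGate (copyPerm φ x₀ n))]

theorem uniformCircuit_prepares (H : Ω → Fin (n + 1)) (U : ι → unitaryGroup S ℂ) (s₀ : S)
    (x₀ : Ω) :
    PreparesDistribution (uniformCircuit S n ι x₀) H U (s₀, x₀, 0, false)
      fun _ => (Fintype.card Ω : ℝ)⁻¹ := by
  have hc : (0 : ℝ) < Fintype.card Ω := by exact_mod_cast Fintype.card_pos_iff.2 ⟨x₀⟩
  have hv : stateNormSq (fun _ : Ω => (((Real.sqrt (Fintype.card Ω))⁻¹ : ℝ) : ℂ)) = 1 := by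
    simp [stateNormSq, hc.ne']
  refine ⟨fun s _ => if s = s₀ then (((Real.sqrt (Fintype.card Ω))⁻¹ : ℝ) : ℂ) else 0, ?_,
    fun x => ?_⟩
  · rw [uniformCircuit, eval_gate]
    funext k
    obtain ⟨s, x, j, b⟩ := k
    have := controlledGate_mulVec (configurationEquiv S Ω n) (fun _ => prepareGate x₀
      fun _ => (((Real.sqrt (Fintype.card Ω))⁻¹ : ℝ) : ℂ))
      (Pi.single (s₀, x₀, 0, false) 1) (s, x, j, b)
    refine this.trans ?_
    simp only [configurationEquiv, Equiv.coe_fn_mk, Equiv.coe_fn_symm_mk]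
    rw [Finset.sum_eq_single x₀ (fun y _ hy => by simp [hy]) (by simp),
      prepareGate_apply hv]
    simp only [Pi.single_apply, Prod.mk.injEq]
    by_cases h1 : s = s₀ <;> by_cases h2 : j = 0 <;> by_cases h3 : b = false <;>
      simp [h1, h2, h3]
  · simp [apply_ite]

/-- The configuration register holds `x₀`, so the transposition of `x₀` and `φ s` writes `φ s` there
reversibly. The label `s` stays behind, which is harmless because only sums over `s` matter. -/
theorem samplerCircuit_prepares (H : Ω → Fin (n + 1)) {U : ι → unitaryGroup S ℂ} {s₀ : S}
    {φ : S → Ω} {i : ι} {p : Ω → ℝ} (h : IsExactSampler s₀ φ (U i) p) (x₀ : Ω) :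
    PreparesDistribution (samplerCircuit φ x₀ n i) H U (s₀, x₀, 0, false) p := by
  refine ⟨fun s x => if φ s = x then (U i : Matrix S S ℂ) s s₀ else 0, ?_, fun x => ?_⟩
  · simp only [samplerCircuit, Circuit.eval, one_mul, UnitaryGroup.mul_val, ← mulVec_mulVec,
      gibbsGate_mulVec]
    funext k
    obtain ⟨s, x, j, b⟩ := k
    rw [permutationGate_mulVec]
    simp only [copyPerm, Equiv.coe_fn_mk, gibbsOracle, applySampler]
    rw [Finset.sum_eq_single s₀ (fun y _ hy => by simp [hy]) (by simp)]
    simp only [Pi.single_apply, Prod.mk.injEq, Equiv.swap_apply_eq_iff, Equiv.swap_apply_left,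
      true_and]
    by_cases h1 : φ s = x
    · simp [h1]
    · have : x ≠ φ s := fun h => h1 h.symm
      simp [h1, this]
  · rw [← h x, Finset.sum_filter]
    refine Finset.sum_congr rfl fun s _ => ?_
    split_ifs with h1 <;> simp [h1]

variable {c : Circuit (GibbsWork S Ω n) (GibbsQuery ι)}

theorem count_flagCircuit (T : GibbsQuery ι → Bool) (v : Fin (n + 1) → ℝ) :
    (flagCircuit c v).count T = c.count T + if T .energy then 1 else 0 := by
  simp [flagCircuit, Circuit.count_append, Circuit.count]

/-- The initial contents of the memory. -/
def initialMemory (s₀ : S) (x₀ : Ω) (n : ℕ) (X : Type) [Zero X] : GibbsMemory S Ω n (Bool × X) :=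
  (s₀, x₀, 0, false, 0)

/-- Measure the energy of a configuration prepared by `c`. -/
def energyRoutine [Zero X] (c : Circuit (GibbsWork S Ω n) (GibbsQuery ι)) (s₀ : S) (x₀ : Ω) :
    Routine (GibbsMemory S Ω n (Bool × X)) (GibbsQuery ι) (Fin (n + 1)) :=
  Circuit.sampleRoutine ((flagCircuit c fun _ => 0).mapGates (liftGate (counterEquiv S Ω n X)))
    (initialMemory s₀ x₀ n X) fun k => k.2.2.1

/-- Estimate the expectation of `v h`, where `h` is the energy of a configuration prepared
by `c`. -/
def amplitudeRoutine (c : Circuit (GibbsWork S Ω n) (GibbsQuery ι)) (s₀ : S) (x₀ : Ω) (q : ℕ)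
    (v : Fin (n + 1) → ℝ) :
    Routine (GibbsMemory S Ω n (Bool × ZMod (4 * q + 1))) (GibbsQuery ι) ℝ :=
  Circuit.sampleRoutine
    (amplitudeCircuit GibbsQuery.inverse (flagCircuit c v) (s₀, x₀, 0, false) (fun k => k.2.2.2) q
      (counterEquiv S Ω n _))
    (initialMemory s₀ x₀ n _) fun k => phaseEstimate k.2.2.2.2

theorem energyRoutine_costLE [Zero X] (s₀ : S) (x₀ : Ω) (T : GibbsQuery ι → Bool) :
    (energyRoutine (X := X) c s₀ x₀).CostLE T (c.count T + if T .energy then 1 else 0) := by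
  have := Circuit.sampleRoutine_costLE
    ((flagCircuit c fun _ => 0).mapGates (liftGate (counterEquiv S Ω n X)))
    (initialMemory s₀ x₀ n X) (fun k => k.2.2.1) T
  rwa [Circuit.count_mapGates, count_flagCircuit] at this

theorem amplitudeRoutine_costLE (s₀ : S) (x₀ : Ω) (q : ℕ) (v : Fin (n + 1) → ℝ)
    {T : GibbsQuery ι → Bool} (hT : ∀ q, T (GibbsQuery.inverse q) = T q) :
    (amplitudeRoutine c s₀ x₀ q v).CostLE T
      ((8 * q + 3) * (c.count T + if T .energy then 1 else 0)) := by
  have := Circuit.sampleRoutine_costLE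
    (amplitudeCircuit GibbsQuery.inverse (flagCircuit c v) (s₀, x₀, 0, false) (fun k => k.2.2.2) q
      (counterEquiv S Ω n _))
    (initialMemory s₀ x₀ n _) (fun k => phaseEstimate k.2.2.2.2) T
  rwa [count_amplitudeCircuit hT, count_flagCircuit] at this

variable {H : Ω → Fin (n + 1)} {U : ι → unitaryGroup S ℂ} {s₀ : S} {x₀ : Ω} {p : Ω → ℝ}

theorem PreparesDistribution.energyRoutine_realizes [Zero X]
    (h : PreparesDistribution c H U (s₀, x₀, 0, false) p) :
    ∃ μ, (energyRoutine (X := X) c s₀ x₀).Realizes (gibbsOracle H U) (initialMemory s₀ x₀ n X) μ ∧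
      ∀ g, μ g = ∑ x, p x * g (H x) := by
  set ψ := ((flagCircuit c fun _ => 0).eval (gibbsGate H U) :
    Matrix (GibbsWork S Ω n) (GibbsWork S Ω n) ℂ) *ᵥ Pi.single (s₀, x₀, 0, false) 1 with hψ
  have hk : initialMemory s₀ x₀ n X = (counterEquiv S Ω n X).symm ((s₀, x₀, 0, false), 0) := rfl
  have hc : (Circuit.eval (fun q => liftGate (counterEquiv S Ω n X) (gibbsGate H U q))
      ((flagCircuit c fun _ => 0).mapGates (liftGate (counterEquiv S Ω n X))) :
      Matrix (GibbsMemory S Ω n (Bool × X)) (GibbsMemory S Ω n (Bool × X)) ℂ) *ᵥ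
        Pi.single (initialMemory s₀ x₀ n X) 1
        = pack (counterEquiv S Ω n X) fun x => (Pi.single 0 1 : X → ℂ) x • ψ := by
    rw [hk, single_eq_pack, Circuit.eval_mapGates (N := gibbsGate H U) _ (fun _ => rfl),
      liftGate_mulVec_pack]
    congr 1
    funext x
    rw [hψ, ← mulVec_smul]
    rfl
  have hn : stateNormSq (pack (counterEquiv S Ω n X) fun x => (Pi.single 0 1 : X → ℂ) x • ψ)
      = 1 := by rw [← hc, stateNormSq_mulVec, stateNormSq_single]
  refine ⟨_, Circuit.sampleRoutine_realizes (gibbsOracle_eq_liftGate H U) _ _ _ hc hn,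
    fun g => ?_⟩
  rw [measureExpectation_apply, ← (counterEquiv S Ω n X).symm.sum_comp, Fintype.sum_prod_type]
  have h2 := h.sum_flagCircuit (v := fun _ => 0) (fun _ => le_rfl) (fun _ => zero_le_one)
    fun j _ => g j
  simp only [sub_zero, one_mul, zero_mul, add_zero] at h2
  rw [← h2]
  refine Finset.sum_congr rfl fun r _ => ?_
  rw [Finset.sum_eq_single 0 (fun x _ hx => by simp [pack, hx]) (by simp)]
  simp [pack, counterEquiv, hψ]

theorem PreparesDistribution.amplitudeRoutine_realizes
    (h : PreparesDistribution c H U (s₀, x₀, 0, false) p) {q : ℕ} (hq : 1 ≤ q)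
    {v : Fin (n + 1) → ℝ} (h0 : ∀ j, 0 ≤ v j) (h1 : ∀ j, v j ≤ 1) :
    ∃ μ, (amplitudeRoutine c s₀ x₀ q v).Realizes (gibbsOracle H U) (initialMemory s₀ x₀ n _) μ ∧
      (μ fun z => (z - ∑ x, p x * v (H x)) ^ 2)
        ≤ 5120 * ((∑ x, p x * v (H x)) / q ^ 2 + 1 / q ^ 4) := by
  refine ⟨_, Circuit.sampleRoutine_realizes (gibbsOracle_eq_liftGate H U) _ _ _ rfl
    (by rw [stateNormSq_mulVec, stateNormSq_single]), ?_⟩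
  have hp : markedProb (fun k : GibbsWork S Ω n => k.2.2.2)
      (((flagCircuit c v).eval (gibbsGate H U) :
        Matrix (GibbsWork S Ω n) (GibbsWork S Ω n) ℂ) *ᵥ Pi.single (s₀, x₀, 0, false) 1)
        = ∑ x, p x * v (H x) := by
    have h2 := h.sum_flagCircuit h0 h1 fun _ b => if b then 1 else 0
    simp only [mul_ite, mul_one, mul_zero, Bool.false_eq_true, if_false, if_true, zero_add] at h2
    exact h2
  rw [measureExpectation_apply, ← hp]
  exact amplitudeCircuit_sq_error (gibbsGate_inverse H U) hq (counterEquiv S Ω n _) rfl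

end GibbsCircuits

/-! ### Dyadic levels -/

section Levels

/-- The number `y`, cut off beyond `2 ^ k`. -/
def cutoff (k : ℕ) (y : ℝ) : ℝ := if y ≤ 2 ^ k then y else 0

/-- The part of `y` on the `k`-th dyadic level, divided by `2 ^ k`. -/
def dyadicLevel : ℕ → ℝ → ℝ
  | 0, y => cutoff 0 y
  | k + 1, y => (cutoff (k + 1) y - cutoff k y) / 2 ^ (k + 1)

variable {y : ℝ}

theorem cutoff_le (hy : 0 ≤ y) (k : ℕ) : cutoff k y ≤ y := by
  rw [cutoff]; split_ifs <;> simp [hy]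

theorem sub_cutoff_le (hy : 0 ≤ y) (k : ℕ) : y - cutoff k y ≤ y ^ 2 / 2 ^ k := by
  rw [cutoff]
  split_ifs with h
  · rw [sub_self]; positivity
  · rw [sub_zero, le_div_iff₀ (by positivity), sq]
    exact mul_le_mul_of_nonneg_left (not_le.1 h).le hy

/-- The difference is `y` if `2^k < y ≤ 2^(k+1)` and `0` otherwise; the last claim uses `2^k < y`.
-/
theorem cutoff_succ_sub (hy : 0 ≤ y) (k : ℕ) :
    0 ≤ cutoff (k + 1) y - cutoff k y ∧ cutoff (k + 1) y - cutoff k y ≤ 2 ^ (k + 1) ∧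
      2 ^ (k + 1) * (cutoff (k + 1) y - cutoff k y)
        ≤ 2 * y * (cutoff (k + 1) y - cutoff k y) := by
  have h2 : (2 : ℝ) ^ (k + 1) = 2 * 2 ^ k := by ring
  have hpos : (0 : ℝ) < 2 ^ k := by positivity
  simp only [cutoff]
  split_ifs with h3 h4 h4
  · rw [sub_self]; exact ⟨le_rfl, by positivity, by simp⟩
  · rw [sub_zero]
    refine ⟨hy, h3, ?_⟩
    rw [h2]
    nlinarith
  · exact absurd (h4.trans (by linarith)) h3
  · rw [sub_self]; exact ⟨le_rfl, by positivity, by simp⟩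

theorem dyadicLevel_nonneg (hy : 0 ≤ y) (k : ℕ) : 0 ≤ dyadicLevel k y := by
  cases k with
  | zero => rw [dyadicLevel, cutoff]; split_ifs <;> simp [hy]
  | succ k => exact div_nonneg (cutoff_succ_sub hy k).1 (by positivity)

theorem dyadicLevel_le_one (hy : 0 ≤ y) (k : ℕ) : dyadicLevel k y ≤ 1 := by
  cases k with
  | zero =>
    rw [dyadicLevel, cutoff]
    split_ifs with h
    · simpa using h
    · exact zero_le_one
  | succ k =>
    rw [dyadicLevel, div_le_one (by positivity)]
    exact (cutoff_succ_sub hy k).2.1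

theorem sum_dyadicLevel (y : ℝ) (K : ℕ) :
    ∑ k ∈ Finset.range (K + 1), 2 ^ k * dyadicLevel k y = cutoff K y := by
  induction K with
  | zero => simp [dyadicLevel]
  | succ K ih =>
    rw [Finset.sum_range_succ, ih, dyadicLevel]
    field_simp
    ring

/-- On a level `k ≥ 1` one factor `2^k` is at most `2y`, and the other restores the part of `y` on
that level; these parts add up to at most `y`. Level `0` accounts for the extra `y`. -/
theorem sum_four_pow_dyadicLevel (hy : 0 ≤ y) (K : ℕ) :
    ∑ k ∈ Finset.range (K + 1), 4 ^ k * dyadicLevel k y ≤ 2 * y ^ 2 + y := by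
  have h : ∑ k ∈ Finset.range (K + 1), 4 ^ k * dyadicLevel k y ≤ 2 * y * cutoff K y + y := by
    induction K with
    | zero =>
      have h1 := dyadicLevel_nonneg hy 0
      have h2 := cutoff_le hy 0
      simp only [dyadicLevel] at h1
      simp only [zero_add, Finset.sum_range_one, pow_zero, one_mul, dyadicLevel]
      nlinarith [mul_nonneg hy h1]
    | succ K ih =>
      rw [Finset.sum_range_succ, dyadicLevel]
      have h4 : (4 : ℝ) ^ (K + 1) * ((cutoff (K + 1) y - cutoff K y) / 2 ^ (K + 1))
          = 2 ^ (K + 1) * (cutoff (K + 1) y - cutoff K y) := by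
        have : (4 : ℝ) ^ (K + 1) = 2 ^ (K + 1) * 2 ^ (K + 1) := by
          rw [← mul_pow]; norm_num
        rw [this]
        field_simp
      rw [h4]
      nlinarith [(cutoff_succ_sub hy K).2.2]
  nlinarith [mul_le_mul_of_nonneg_left (cutoff_le hy K) hy]

end Levels

/-! ### Estimating an expectation with bounded relative second moment -/

section MeanEstimation

/-- Jensen's inequality, through `|f| ≤ f²/(2s) + s/2`. -/
theorem Expectation.abs_le_of_sq_le {α : Type*} (μ : Expectation α) (f : α → ℝ) {s : ℝ}
    (hs : 0 < s) (h : (μ fun a => f a ^ 2) ≤ s ^ 2) : (μ fun a => |f a|) ≤ s := by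
  have h1 : (μ fun a => |f a|) ≤ μ fun a => (2 * s)⁻¹ * f a ^ 2 + s / 2 := by
    refine μ.mono fun a => ?_
    rw [← sub_nonneg]
    have : (2 * s)⁻¹ * f a ^ 2 + s / 2 - |f a| = (2 * s)⁻¹ * (|f a| - s) ^ 2 := by
      rw [← sq_abs (f a)]
      field_simp
      ring
    rw [this]
    positivity
  rw [Expectation.add, Expectation.const_mul, Expectation.const] at h1
  calc _ ≤ (2 * s)⁻¹ * s ^ 2 + s / 2 :=
        h1.trans (add_le_add_left (mul_le_mul_of_nonneg_left h (by positivity)) _)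
    _ = s := by field_simp; ring

/-- `72² = 5184 ≥ 5120`, and the square of a sum of nonnegative numbers dominates the sum of
squares. -/
theorem abs_error_le_of_sq_error {α : Type*} (μ : Expectation α) (f : α → ℝ) {p q : ℝ}
    (hp : 0 ≤ p) (hq : 0 < q)
    (h : (μ fun a => f a ^ 2) ≤ 5120 * (p / q ^ 2 + 1 / q ^ 4)) :
    (μ fun a => |f a|) ≤ 72 * (Real.sqrt p / q + 1 / q ^ 2) := by
  have hsp := Real.sqrt_nonneg p
  refine μ.abs_le_of_sq_le f (by positivity) (h.trans ?_)
  have h1 : (Real.sqrt p / q + 1 / q ^ 2) ^ 2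
      = p / q ^ 2 + 1 / q ^ 4 + 2 * (Real.sqrt p / q * (1 / q ^ 2)) := by
    have := Real.sq_sqrt hp
    calc _ = Real.sqrt p ^ 2 / q ^ 2 + 1 / q ^ 4 + 2 * (Real.sqrt p / q * (1 / q ^ 2)) := by ring
      _ = _ := by rw [this]
  have h2 : 0 ≤ Real.sqrt p / q * (1 / q ^ 2) := by positivity
  have h3 : 0 ≤ p / q ^ 2 + 1 / q ^ 4 := by positivity
  rw [mul_pow, h1]
  nlinarith

variable {Ω : Type} [Fintype Ω] {w Y : Ω → ℝ}

/-- Cauchy–Schwarz over the levels; the price is the factor `K + 1`, which later enters `q` as a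
square root. -/
theorem sum_dyadic_sqrt_le (hw : ∀ x, 0 ≤ w x) (hY : ∀ x, 0 ≤ Y x) (K : ℕ) :
    (∑ k : Fin (K + 1), 2 ^ (k : ℕ) * Real.sqrt (∑ x, w x * dyadicLevel k (Y x))) ^ 2
      ≤ (K + 1) * (2 * ∑ x, w x * Y x ^ 2 + ∑ x, w x * Y x) := by
  have h1 := sq_sum_le_card_mul_sum_sq (s := (Finset.univ : Finset (Fin (K + 1))))
    (f := fun k => 2 ^ (k : ℕ) * Real.sqrt (∑ x, w x * dyadicLevel k (Y x)))
  rw [Finset.card_univ, Fintype.card_fin] at h1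
  push_cast at h1
  refine h1.trans (mul_le_mul_of_nonneg_left ?_ (by positivity))
  have h2 : ∀ k : Fin (K + 1), (2 ^ (k : ℕ) * Real.sqrt (∑ x, w x * dyadicLevel k (Y x))) ^ 2
      = ∑ x, w x * (4 ^ (k : ℕ) * dyadicLevel k (Y x)) := by
    intro k
    rw [mul_pow, Real.sq_sqrt (Finset.sum_nonneg fun x _ =>
      mul_nonneg (hw x) (dyadicLevel_nonneg (hY x) k)), ← pow_mul, mul_comm (k : ℕ) 2, pow_mul,
      Finset.mul_sum]
    norm_num
    exact Finset.sum_congr rfl fun x _ => by ring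
  simp only [h2]
  rw [Finset.sum_comm, Finset.mul_sum, ← Finset.sum_add_distrib]
  refine Finset.sum_le_sum fun x _ => ?_
  rw [← Finset.mul_sum, Fin.sum_univ_eq_sum_range (fun k => (4 : ℝ) ^ k * dyadicLevel k (Y x))]
  have := mul_le_mul_of_nonneg_left (sum_four_pow_dyadicLevel (hY x) K) (hw x)
  linarith

/-- The levels recombine to the cut-off, so the bias is the mean of the part beyond `2^K`,
controlled by the second moment. -/
theorem sum_dyadic_bias (hw : ∀ x, 0 ≤ w x) (hY : ∀ x, 0 ≤ Y x) (K : ℕ) :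
    |(∑ k : Fin (K + 1), 2 ^ (k : ℕ) * ∑ x, w x * dyadicLevel k (Y x)) - ∑ x, w x * Y x|
      ≤ (∑ x, w x * Y x ^ 2) / 2 ^ K := by
  have h1 : (∑ k : Fin (K + 1), 2 ^ (k : ℕ) * ∑ x, w x * dyadicLevel k (Y x))
      = ∑ x, w x * cutoff K (Y x) := by
    simp only [← sum_dyadicLevel,
      ← Fin.sum_univ_eq_sum_range (fun k => (2 : ℝ) ^ k * dyadicLevel k _), Finset.mul_sum]
    rw [Finset.sum_comm]
    exact Finset.sum_congr rfl fun x _ => Finset.sum_congr rfl fun k _ => by ring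
  rw [h1, abs_sub_comm, ← Finset.sum_sub_distrib, Finset.sum_div]
  refine (Finset.abs_sum_le_sum_abs _ _).trans (Finset.sum_le_sum fun x _ => ?_)
  rw [← mul_sub, abs_mul, abs_of_nonneg (hw x), abs_of_nonneg (sub_nonneg.2 (cutoff_le (hY x) K)),
    mul_div_assoc]
  exact mul_le_mul_of_nonneg_left (sub_cutoff_le (hY x) K) (hw x)

/-- The relative error of the dyadic estimator, given a rough estimate `m` of the expectation `μ`
of `X`. -/
theorem dyadic_relative_error {X : Ω → ℝ} (hw : ∀ x, 0 ≤ w x) (hX : ∀ x, 0 ≤ X x) {μ B m : ℝ}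
    (hμ : 0 < μ) (hB : 1 ≤ B) (h1 : ∑ x, w x * X x = μ) (h2 : ∑ x, w x * X x ^ 2 ≤ B * μ ^ 2)
    (hm : μ / 2 ≤ m) (hm' : m ≤ 3 * μ / 2) {q K : ℕ} (hq : 1 ≤ q)
    (ν : Fin (K + 1) → Expectation ℝ)
    (hν : ∀ k, ((ν k) fun z => (z - ∑ x, w x * dyadicLevel k (X x / m)) ^ 2)
      ≤ 5120 * ((∑ x, w x * dyadicLevel k (X x / m)) / (q : ℝ) ^ 2 + 1 / (q : ℝ) ^ 4)) :
    (Expectation.pi ν fun z => |m * (∑ k : Fin (K + 1), 2 ^ (k : ℕ) * z k) / μ - 1|)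
      ≤ 144 * Real.sqrt ((K + 1) * B) / q + 216 * 2 ^ K / q ^ 2 + 2 * B / 2 ^ K := by
  have hm0 : 0 < m := by linarith
  have hq0 : (0 : ℝ) < q := by exact_mod_cast hq
  set Y : Ω → ℝ := fun x => X x / m with hYdef
  have hY : ∀ x, 0 ≤ Y x := fun x => div_nonneg (hX x) hm0.le
  set p : Fin (K + 1) → ℝ := fun k => ∑ x, w x * dyadicLevel k (Y x) with hpdef
  have hp : ∀ k, 0 ≤ p k := fun k =>
    Finset.sum_nonneg fun x _ => mul_nonneg (hw x) (dyadicLevel_nonneg (hY x) k)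
  have hY1 : ∑ x, w x * Y x = μ / m := by
    rw [← h1, Finset.sum_div]
    exact Finset.sum_congr rfl fun x _ => by simp only [hYdef]; ring
  have hY2 : ∑ x, w x * Y x ^ 2 ≤ B * μ ^ 2 / m ^ 2 := by
    have : ∑ x, w x * Y x ^ 2 = (∑ x, w x * X x ^ 2) / m ^ 2 := by
      rw [Finset.sum_div]
      exact Finset.sum_congr rfl fun x _ => by simp only [hYdef]; ring
    rw [this]
    gcongr
  have hbias : m / μ * |(∑ k : Fin (K + 1), 2 ^ (k : ℕ) * p k) - μ / m| ≤ 2 * B / 2 ^ K := by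
    have h := sum_dyadic_bias hw hY K
    rw [hY1] at h
    calc m / μ * |(∑ k : Fin (K + 1), 2 ^ (k : ℕ) * p k) - μ / m|
        ≤ m / μ * ((B * μ ^ 2 / m ^ 2) / 2 ^ K) := by
          refine mul_le_mul_of_nonneg_left (h.trans ?_) (by positivity)
          gcongr
      _ = B / 2 ^ K * (μ / m) := by field_simp
      _ ≤ B / 2 ^ K * 2 := by
          refine mul_le_mul_of_nonneg_left ?_ (by positivity)
          rw [div_le_iff₀ hm0]; linarith
      _ = _ := by ring
  have hroot : m / μ * ∑ k : Fin (K + 1), 2 ^ (k : ℕ) * Real.sqrt (p k)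
      ≤ 2 * Real.sqrt ((K + 1) * B) := by
    have h := sum_dyadic_sqrt_le hw hY K
    rw [hY1] at h
    have hr : 2 * Real.sqrt ((K + 1) * B) = Real.sqrt (4 * ((K + 1) * B)) := by
      rw [Real.sqrt_mul zero_le_four, show (4 : ℝ) = 2 ^ 2 by norm_num,
        Real.sqrt_sq zero_le_two]
    rw [hr]
    apply Real.le_sqrt_of_sq_le
    rw [mul_pow]
    calc (m / μ) ^ 2 * (∑ k : Fin (K + 1), 2 ^ (k : ℕ) * Real.sqrt (p k)) ^ 2
        ≤ (m / μ) ^ 2 * ((K + 1) * (2 * (B * μ ^ 2 / m ^ 2) + μ / m)) := by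
          refine mul_le_mul_of_nonneg_left (h.trans ?_) (by positivity)
          gcongr
      _ = (K + 1) * (2 * B + m / μ) := by field_simp
      _ ≤ (K + 1) * (4 * B) := by
          have : m / μ ≤ 3 / 2 := by rw [div_le_iff₀ hμ]; linarith
          refine mul_le_mul_of_nonneg_left ?_ (by positivity)
          linarith
      _ = _ := by ring
  have hgeom : ∑ k : Fin (K + 1), (2 : ℝ) ^ (k : ℕ) ≤ 2 * 2 ^ K := by
    rw [Fin.sum_univ_eq_sum_range (fun k => (2 : ℝ) ^ k), geom_sum_eq (by norm_num)]
    rw [pow_succ]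
    norm_num
    linarith
  have hpoint : ∀ z : Fin (K + 1) → ℝ, |m * (∑ k : Fin (K + 1), 2 ^ (k : ℕ) * z k) / μ - 1|
      ≤ m / μ * (∑ k : Fin (K + 1), 2 ^ (k : ℕ) * |z k - p k|) + 2 * B / 2 ^ K := by
    intro z
    have h3 : m * (∑ k : Fin (K + 1), 2 ^ (k : ℕ) * z k) / μ - 1
        = m / μ * (∑ k : Fin (K + 1), 2 ^ (k : ℕ) * (z k - p k))
          + m / μ * ((∑ k : Fin (K + 1), 2 ^ (k : ℕ) * p k) - μ / m) := by
      simp only [mul_sub, Finset.sum_sub_distrib]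
      field_simp
      ring
    rw [h3]
    refine (abs_add_le _ _).trans (add_le_add ?_ ?_)
    · rw [abs_mul, abs_of_pos (by positivity : 0 < m / μ)]
      refine mul_le_mul_of_nonneg_left ((Finset.abs_sum_le_sum_abs _ _).trans_eq ?_)
        (by positivity)
      refine Finset.sum_congr rfl fun k _ => ?_
      rw [abs_mul, abs_of_pos (by positivity : (0 : ℝ) < 2 ^ (k : ℕ))]
    · rw [abs_mul, abs_of_pos (by positivity : 0 < m / μ)]
      exact hbias
  refine ((Expectation.pi ν).mono hpoint).trans ?_
  rw [Expectation.add, Expectation.const, Expectation.const_mul, Expectation.sum]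
  refine add_le_add_left ?_ _
  have hk : ∀ k : Fin (K + 1), (Expectation.pi ν fun z => 2 ^ (k : ℕ) * |z k - p k|)
      ≤ 2 ^ (k : ℕ) * (72 * (Real.sqrt (p k) / q + 1 / q ^ 2)) := by
    intro k
    rw [Expectation.const_mul, Expectation.pi_eval ν k fun z => |z - p k|]
    exact mul_le_mul_of_nonneg_left
      (abs_error_le_of_sq_error (ν k) (fun z => z - p k) (hp k) hq0 (hν k)) (by positivity)
  calc m / μ * ∑ k : Fin (K + 1), (Expectation.pi ν fun z => 2 ^ (k : ℕ) * |z k - p k|)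
      ≤ m / μ * ∑ k : Fin (K + 1), 2 ^ (k : ℕ) * (72 * (Real.sqrt (p k) / q + 1 / q ^ 2)) :=
        mul_le_mul_of_nonneg_left (Finset.sum_le_sum fun k _ => hk k) (by positivity)
    _ = 72 / q * (m / μ * ∑ k : Fin (K + 1), 2 ^ (k : ℕ) * Real.sqrt (p k))
        + 72 / q ^ 2 * (m / μ * ∑ k : Fin (K + 1), (2 : ℝ) ^ (k : ℕ)) := by
        have : ∀ k : Fin (K + 1), (2 : ℝ) ^ (k : ℕ) * (72 * (Real.sqrt (p k) / q + 1 / q ^ 2))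
            = 72 / q * (2 ^ (k : ℕ) * Real.sqrt (p k)) + 72 / q ^ 2 * 2 ^ (k : ℕ) :=
          fun k => by ring
        simp only [this, Finset.sum_add_distrib, ← Finset.mul_sum]
        ring
    -- Here `hroot` bounds the first sum, and `m/μ ≤ 3/2` with the geometric sum the second: `144 =
    -- 72 · 2` and `216 = 72 · 3/2 · 2`.
    _ ≤ 72 / q * (2 * Real.sqrt ((K + 1) * B)) + 72 / q ^ 2 * (3 / 2 * (2 * 2 ^ K)) := by
        have h32 : m / μ ≤ 3 / 2 := by rw [div_le_iff₀ hμ]; linarith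
        have h6 := mul_le_mul h32 hgeom (by positivity) (by norm_num)
        gcongr
    _ = _ := by ring

/-- The mean of `N` independent samples. -/
theorem sample_mean_sq_error {α : Type} (μ : Expectation α) (f : α → ℝ) {c V : ℝ} (hc : μ f = c)
    (hV : (μ fun a => f a ^ 2) ≤ V) {N : ℕ} (hN : 1 ≤ N) :
    (Expectation.pi (fun _ : Fin N => μ) fun a => ((∑ i, f (a i)) / N - c) ^ 2) ≤ V / N := by
  have hN0 : (0 : ℝ) < N := by exact_mod_cast hN
  have h0 : (μ fun a => f a - c) = 0 := by rw [Expectation.sub, Expectation.const, hc, sub_self]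
  have h1 := Expectation.pi_sum_sq (k := N) μ (f := fun a => f a - c) h0
  have h2 : (fun a : Fin N → α => ((∑ i, f (a i)) / N - c) ^ 2)
      = fun a => ((N : ℝ) ^ 2)⁻¹ * (∑ i, (f (a i) - c)) ^ 2 := by
    funext a
    rw [Finset.sum_sub_distrib, Finset.sum_const, Finset.card_univ, Fintype.card_fin,
      nsmul_eq_mul]
    field_simp
  have h3 : (μ fun a => (f a - c) ^ 2) ≤ V := by
    have : (fun a => (f a - c) ^ 2) = fun a => f a ^ 2 - ((2 * c) * f a - c ^ 2) := by
      funext a; ring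
    rw [this, Expectation.sub, Expectation.sub, Expectation.const, Expectation.const_mul, hc]
    nlinarith [sq_nonneg c]
  rw [h2, Expectation.const_mul, h1]
  calc _ = (μ fun a => (f a - c) ^ 2) / N := by field_simp
    _ ≤ V / N := by gcongr

end MeanEstimation

/-! ### Estimating one quotient of partition functions -/

section Ratio

variable {S Ω ι : Type} {n : ℕ} [Fintype S] [DecidableEq S] [Fintype Ω] [DecidableEq Ω]

/-- The mean of the values of `f` on a sample. -/
def sampleMean {α : Type} {N : ℕ} (f : α → ℝ) (a : Fin N → α) : ℝ := (∑ i, f (a i)) / N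

/-- Estimate the expectation of `f h`, where `h` is the energy of a configuration prepared by `c`:
take the mean of `N` samples for the scale, then estimate amplitudes on `K + 1` dyadic levels. -/
def meanRoutine (c : Circuit (GibbsWork S Ω n) (GibbsQuery ι)) (s₀ : S) (x₀ : Ω)
    (f : Fin (n + 1) → ℝ) (N K q : ℕ) :
    Routine (GibbsMemory S Ω n (Bool × ZMod (4 * q + 1))) (GibbsQuery ι) ℝ :=
  (Routine.pi fun _ : Fin N => energyRoutine c s₀ x₀).bind fun a =>
    (Routine.pi fun k : Fin (K + 1) => amplitudeRoutine c s₀ x₀ q fun j =>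
      dyadicLevel k (f j / sampleMean f a)).map fun z =>
        sampleMean f a * ∑ k : Fin (K + 1), 2 ^ (k : ℕ) * z k

variable {c : Circuit (GibbsWork S Ω n) (GibbsQuery ι)} {s₀ : S} {x₀ : Ω}

theorem meanRoutine_costLE (f : Fin (n + 1) → ℝ) (N K q : ℕ) {T : GibbsQuery ι → Bool}
    (hT : ∀ q, T (GibbsQuery.inverse q) = T q) :
    (meanRoutine c s₀ x₀ f N K q).CostLE T
      ((N + (K + 1) * (8 * q + 3)) * (c.count T + if T .energy then 1 else 0)) := by
  rw [add_mul, mul_assoc]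
  exact (Routine.CostLE.pi fun _ => energyRoutine_costLE s₀ x₀ T).bind fun a =>
    (Routine.CostLE.pi fun k => amplitudeRoutine_costLE s₀ x₀ q _ hT).map _

variable {H : Ω → Fin (n + 1)} {U : ι → unitaryGroup S ℂ} {p : Ω → ℝ}

/-- By Chebyshev the scale is wrong with probability at most `4B/N`, and then the capped loss is at
most `ε`. The cap is what keeps `N` independent of `1/ε`. -/
theorem meanRoutine_realizes (h : PreparesDistribution c H U (s₀, x₀, 0, false) p)
    {f : Fin (n + 1) → ℝ} (hf : ∀ j, 0 ≤ f j) {μ B ε : ℝ} (hμ : 0 < μ) (hB : 1 ≤ B) (hε : 0 ≤ ε)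
    (h1 : ∑ x, p x * f (H x) = μ) (h2 : ∑ x, p x * f (H x) ^ 2 ≤ B * μ ^ 2) {N K q : ℕ}
    (hN : 1 ≤ N) (hq : 1 ≤ q) :
    ∃ ν, (meanRoutine c s₀ x₀ f N K q).Realizes (gibbsOracle H U) (initialMemory s₀ x₀ n _) ν ∧
      (ν fun v => min |v / μ - 1| ε)
        ≤ 144 * Real.sqrt ((K + 1) * B) / q + 216 * 2 ^ K / q ^ 2 + 2 * B / 2 ^ K
          + 4 * ε * B / N := by
  have hp : ∀ x, 0 ≤ p x := by
    obtain ⟨χ, -, hχ⟩ := h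
    intro x
    rw [← hχ]
    positivity
  obtain ⟨μ₁, hr₁, hμ₁⟩ := h.energyRoutine_realizes (X := ZMod (4 * q + 1))
  -- The sample mean may be `0`; division by it then gives `0`, and the levels still lie in `[0,
  -- 1]`.
  have hmean : ∀ a : Fin N → Fin (n + 1), 0 ≤ sampleMean f a := fun a =>
    div_nonneg (Finset.sum_nonneg fun i _ => hf _) (Nat.cast_nonneg N)
  have hy : ∀ (a : Fin N → Fin (n + 1)) j, 0 ≤ f j / sampleMean f a :=
    fun a j => div_nonneg (hf j) (hmean a)
  choose ν hνr hν using fun (a : Fin N → Fin (n + 1)) (k : Fin (K + 1)) =>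
    h.amplitudeRoutine_realizes hq (v := fun j => dyadicLevel k (f j / sampleMean f a))
      (fun j => dyadicLevel_nonneg (hy a j) k) (fun j => dyadicLevel_le_one (hy a j) k)
  refine ⟨_, (Routine.Realizes.pi fun _ => hr₁).bind fun a =>
    (Routine.Realizes.pi (hνr a)).map _, ?_⟩
  rw [Expectation.bind_apply]
  simp only [Expectation.map_apply]
  set R := 144 * Real.sqrt ((K + 1) * B) / q + 216 * 2 ^ K / q ^ 2 + 2 * B / 2 ^ K with hR
  have hR0 : 0 ≤ R := by positivity
  -- Chebyshev's inequality before averaging: the last term is at least `ε` unless the scale is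
  -- within `μ / 2` of `μ`.
  have hpoint : ∀ a : Fin N → Fin (n + 1), (Expectation.pi (ν a) fun z =>
      min |sampleMean f a * (∑ k : Fin (K + 1), 2 ^ (k : ℕ) * z k) / μ - 1| ε)
        ≤ R + 4 * ε / μ ^ 2 * (sampleMean f a - μ) ^ 2 := by
    intro a
    have hnn : 0 ≤ 4 * ε / μ ^ 2 * (sampleMean f a - μ) ^ 2 := by positivity
    by_cases hm : |sampleMean f a - μ| ≤ μ / 2
    · rw [abs_le] at hm
      have := dyadic_relative_error hp (fun x => hf (H x)) hμ hB h1 h2 (m := sampleMean f a)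
        (by linarith) (by linarith) hq (ν a) (hν a)
      have h3 := (Expectation.pi (ν a)).mono (fun z => min_le_left
        |sampleMean f a * (∑ k : Fin (K + 1), 2 ^ (k : ℕ) * z k) / μ - 1| ε)
      linarith
    · have h3 := (Expectation.pi (ν a)).mono (fun z => min_le_right
        |sampleMean f a * (∑ k : Fin (K + 1), 2 ^ (k : ℕ) * z k) / μ - 1| ε)
      rw [Expectation.const] at h3
      have h4 : (μ / 2) ^ 2 ≤ (sampleMean f a - μ) ^ 2 := by
        rw [← sq_abs (sampleMean f a - μ)]
        exact pow_le_pow_left₀ (by positivity) (not_le.1 hm).le 2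
      have h5 : ε ≤ 4 * ε / μ ^ 2 * (sampleMean f a - μ) ^ 2 := by
        calc ε = 4 * ε / μ ^ 2 * (μ / 2) ^ 2 := by field_simp; norm_num
          _ ≤ _ := mul_le_mul_of_nonneg_left h4 (by positivity)
      linarith
  refine ((Expectation.pi fun _ : Fin N => μ₁).mono hpoint).trans ?_
  rw [Expectation.add, Expectation.const, Expectation.const_mul]
  have h6 := sample_mean_sq_error μ₁ f (c := μ) (V := B * μ ^ 2) ((hμ₁ f).trans h1)
    ((hμ₁ _).trans_le h2) hN
  refine add_le_add_right ?_ R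
  calc _ ≤ 4 * ε / μ ^ 2 * (B * μ ^ 2 / N) :=
        mul_le_mul_of_nonneg_left h6 (by positivity)
    _ = _ := by field_simp

end Ratio

/-! ### Partition functions -/

section PartitionFunctions

variable {Ω : Type} [Fintype Ω] {n : ℕ} {H : Ω → Fin (n + 1)}

theorem boltzmannWeight_nonneg (b : ℝ≥0∞) (h : ℕ) : 0 ≤ boltzmannWeight b h := by
  rw [boltzmannWeight]
  split_ifs <;> positivity

theorem boltzmannWeight_pos {b : ℝ≥0∞} (hb : b ≠ ⊤) (h : ℕ) : 0 < boltzmannWeight b h := by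
  rw [boltzmannWeight, if_neg hb]
  positivity

theorem boltzmannWeight_zero (h : ℕ) : boltzmannWeight 0 h = 1 := by simp [boltzmannWeight]

/-- This makes the Chebyshev quotient a relative second moment. At `b' = ∞` the weights are `0` or
`1`, hence equal to their squares, and `2b' - b = ∞`. -/
theorem boltzmannWeight_sq_div {b b' : ℝ≥0∞} (hb : b < b') (h : ℕ) :
    boltzmannWeight b' h ^ 2 / boltzmannWeight b h = boltzmannWeight (2 * b' - b) h := by
  have hb' : b ≠ ⊤ := hb.ne_top
  by_cases ht : b' = ⊤
  · have : 2 * b' - b = ⊤ := by rw [ht, ENNReal.mul_top (by norm_num), ENNReal.top_sub hb']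
    rw [this, ht, boltzmannWeight, boltzmannWeight, if_pos rfl, if_neg hb']
    split_ifs with h0 <;> simp [h0]
  · have h2 : 2 * b' ≠ ⊤ := ENNReal.mul_ne_top (by norm_num) ht
    have h3 : 2 * b' - b ≠ ⊤ := ENNReal.sub_ne_top h2
    have hle : b ≤ 2 * b' := hb.le.trans (by rw [two_mul]; exact le_self_add)
    rw [boltzmannWeight, boltzmannWeight, boltzmannWeight, if_neg ht, if_neg hb', if_neg h3,
      ENNReal.toReal_sub_of_le hle h2, ENNReal.toReal_mul, ← Real.exp_nat_mul, ← Real.exp_sub]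
    congr 1
    simp
    ring

theorem partitionFunction_pos [Nonempty Ω] {b : ℝ≥0∞} (hb : b ≠ ⊤) :
    0 < partitionFunction H b :=
  Finset.sum_pos (fun _ _ => boltzmannWeight_pos hb _) Finset.univ_nonempty

theorem partitionFunction_zero : partitionFunction H 0 = Fintype.card Ω := by
  simp [partitionFunction, boltzmannWeight_zero]

theorem gibbsDistribution_zero (x : Ω) :
    gibbsDistribution H 0 x = (Fintype.card Ω : ℝ)⁻¹ := by
  rw [gibbsDistribution, partitionFunction_zero, boltzmannWeight_zero, one_div]

/-- The quotient of two Boltzmann factors. -/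
def boltzmannRatio (b b' : ℝ≥0∞) (h : ℕ) : ℝ := boltzmannWeight b' h / boltzmannWeight b h

theorem boltzmannRatio_nonneg (b b' : ℝ≥0∞) (h : ℕ) : 0 ≤ boltzmannRatio b b' h :=
  div_nonneg (boltzmannWeight_nonneg _ _) (boltzmannWeight_nonneg _ _)

theorem sum_gibbs_mul_ratio {b : ℝ≥0∞} (hb : b ≠ ⊤) (b' : ℝ≥0∞) :
    ∑ x, gibbsDistribution H b x * boltzmannRatio b b' (H x)
      = partitionFunction H b' / partitionFunction H b := by
  rw [partitionFunction, Finset.sum_div]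
  refine Finset.sum_congr rfl fun x _ => ?_
  have := (boltzmannWeight_pos hb (H x)).ne'
  rw [gibbsDistribution, boltzmannRatio]
  field_simp

theorem sum_gibbs_mul_ratio_sq {b b' : ℝ≥0∞} (hb : b < b') :
    ∑ x, gibbsDistribution H b x * boltzmannRatio b b' (H x) ^ 2
      = partitionFunction H (2 * b' - b) / partitionFunction H b := by
  rw [partitionFunction, Finset.sum_div]
  refine Finset.sum_congr rfl fun x _ => ?_
  have := (boltzmannWeight_pos hb.ne_top (H x)).ne'
  rw [gibbsDistribution, boltzmannRatio, ← boltzmannWeight_sq_div hb]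
  field_simp

theorem prod_succ_div_castSucc {l : ℕ} (f : Fin (l + 1) → ℝ) (hf : ∀ i, f i ≠ 0) :
    ∏ i : Fin l, f i.succ / f i.castSucc = f (Fin.last l) / f 0 := by
  induction l with
  | zero => simp [div_self (hf 0)]
  | succ l ih =>
    rw [Fin.prod_univ_castSucc]
    have := ih (fun i => f i.castSucc) fun i => hf _
    simp only [Fin.succ_castSucc] at this ⊢
    rw [this, Fin.succ_last, Fin.castSucc_zero]
    have h1 := hf (Fin.last l).castSucc
    field_simp

/-- The product of estimates with small relative errors. -/
theorem abs_prod_sub_le {l : ℕ} {μ v : Fin l → ℝ} (hμ : ∀ i, 0 < μ i) {ε : ℝ} (hε : ε ≤ 1)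
    (h : ∑ i, |v i / μ i - 1| ≤ ε / 2) : |∏ i, v i - ∏ i, μ i| ≤ ε * ∏ i, μ i := by
  have hP : 0 < ∏ i, μ i := Finset.prod_pos fun i _ => hμ i
  -- `|∏ (1 + aᵢ) - 1| ≤ exp (∑ |aᵢ|) - 1 ≤ 2 ∑ |aᵢ|` for `∑ |aᵢ| ≤ 1`.
  have h1 := Finset.norm_prod_one_add_sub_one_le Finset.univ fun i => v i / μ i - 1
  simp only [add_sub_cancel, Real.norm_eq_abs, Finset.prod_div_distrib] at h1
  have h0 : 0 ≤ ∑ i, |v i / μ i - 1| := Finset.sum_nonneg fun i _ => abs_nonneg _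
  have h2 : Real.exp (∑ i, |v i / μ i - 1|) - 1 ≤ ε := by
    have := Real.abs_exp_sub_one_le (x := ∑ i, |v i / μ i - 1|)
      (by rw [abs_of_nonneg h0]; linarith)
    rw [abs_of_nonneg h0] at this
    linarith [le_abs_self (Real.exp (∑ i, |v i / μ i - 1|) - 1)]
  have h3 : ∏ i, v i - ∏ i, μ i = ((∏ i, v i) / (∏ i, μ i) - 1) * ∏ i, μ i := by
    field_simp
  rw [h3, abs_mul, abs_of_pos hP]
  exact mul_le_mul_of_nonneg_right (h1.trans h2) hP.le

end PartitionFunctions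

/-! ### The complete algorithm -/

section Algorithm

theorem Routine.CostLE.mono {K Q α : Type} [Fintype K] [DecidableEq K] {P : Routine K Q α}
    {T : Q → Bool} {m n : ℕ} (hP : P.CostLE T m) (h : m ≤ n) : P.CostLE T n :=
  fun c b hc => (hP c b hc).trans (Nat.add_le_add_right h b)

variable {S Ω : Type} {n l : ℕ} [Fintype S] [DecidableEq S] [Fintype Ω] [DecidableEq Ω]

/-- Prepare the Gibbs distribution at the `i`-th temperature. -/
def stageCircuit (φ : InteriorIndex l → S → Ω) (x₀ : Ω) (n : ℕ) (i : Fin l) :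
    Circuit (GibbsWork S Ω n) (GibbsQuery (InteriorIndex l)) :=
  if h : i.castSucc = 0 then uniformCircuit S n _ x₀
  else samplerCircuit (φ ⟨i.castSucc, h, (Fin.castSucc_lt_last i).ne⟩) x₀ n
    ⟨i.castSucc, h, (Fin.castSucc_lt_last i).ne⟩

theorem count_stageCircuit_le (φ : InteriorIndex l → S → Ω) (x₀ : Ω) (i : Fin l) :
    (stageCircuit φ x₀ n i).count GibbsQuery.isSample ≤ 1 ∧
      (stageCircuit φ x₀ n i).count GibbsQuery.isEnergy = 0 := by
  rw [stageCircuit]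
  split_ifs <;>
    simp [uniformCircuit, samplerCircuit, Circuit.count, GibbsQuery.isSample, GibbsQuery.isEnergy]

theorem stageCircuit_prepares {φ : InteriorIndex l → S → Ω} {s₀ : S} {β : Fin (l + 1) → ℝ≥0∞}
    (hβ : β 0 = 0) {H : Ω → Fin (n + 1)} {U : InteriorIndex l → Matrix.unitaryGroup S ℂ}
    (hU : ∀ i, IsExactSampler s₀ (φ i) (U i) (gibbsDistribution H (β i))) (x₀ : Ω) (i : Fin l) :
    PreparesDistribution (stageCircuit φ x₀ n i) H U (s₀, x₀, 0, false)
      (gibbsDistribution H (β i.castSucc)) := by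
  rw [stageCircuit]
  split_ifs with h
  · have := uniformCircuit_prepares H U s₀ x₀
    rw [h, hβ]
    convert this using 1
    funext x
    exact gibbsDistribution_zero x
  · exact samplerCircuit_prepares H (hU ⟨i.castSucc, h, (Fin.castSucc_lt_last i).ne⟩) x₀

/-- Estimate all the quotients of successive values of the partition function, and multiply. -/
def coolingProgram (β : Fin (l + 1) → ℝ≥0∞) (φ : InteriorIndex l → S → Ω) (s₀ : S) (x₀ : Ω)
    (n N K q : ℕ) : QuantumProgram (GibbsMemory S Ω n (Bool × ZMod (4 * q + 1)))
      (GibbsQuery (InteriorIndex l)) :=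
  Routine.pi (fun i : Fin l => meanRoutine (stageCircuit φ x₀ n i) s₀ x₀
      (fun j => boltzmannRatio (β i.castSucc) (β i.succ) j) N K q)
    fun v => .output (Fintype.card Ω * ∏ i, v i)

/-- The algorithm with the program `coolingProgram`. -/
def coolingAlgorithm (β : Fin (l + 1) → ℝ≥0∞) (φ : InteriorIndex l → S → Ω) (s₀ : S) (x₀ : Ω)
    (n N K q : ℕ) : GibbsAlgorithm S Ω n (InteriorIndex l) where
  W := Bool × ZMod (4 * q + 1)
  start := initialMemory s₀ x₀ n _
  program := coolingProgram β φ s₀ x₀ n N K q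

/-- A flag circuit contains at most one sample (none at `β₀ = 0`) and exactly one energy evaluation,
so both counts have the same bound. -/
theorem coolingAlgorithm_counts (β : Fin (l + 1) → ℝ≥0∞) (φ : InteriorIndex l → S → Ω) (s₀ : S)
    (x₀ : Ω) (n N K q : ℕ) :
    (coolingAlgorithm β φ s₀ x₀ n N K q).sampleCount ≤ l * (N + (K + 1) * (8 * q + 3)) ∧
      (coolingAlgorithm β φ s₀ x₀ n N K q).energyCount ≤ l * (N + (K + 1) * (8 * q + 3)) := by
  have h : ∀ T : GibbsQuery (InteriorIndex l) → Bool, (∀ q, T (GibbsQuery.inverse q) = T q) →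
      (∀ i, (stageCircuit φ x₀ n i).count T + (if T .energy then 1 else 0) ≤ 1) →
      (coolingProgram β φ s₀ x₀ n N K q).queryCount T
        ≤ l * (N + (K + 1) * (8 * q + 3)) := by
    intro T hT hc
    exact Routine.CostLE.pi (fun i => (meanRoutine_costLE _ N K q hT).mono
      ((Nat.mul_le_mul_left _ (hc i)).trans_eq (mul_one _)))
        (fun v => .output (Fintype.card Ω * ∏ i, v i)) 0 fun _ => le_rfl
  refine ⟨h _ GibbsQuery.isSample_inverse fun i => ?_, h _ GibbsQuery.isEnergy_inverse fun i => ?_⟩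
  · simpa [GibbsQuery.isSample] using (count_stageCircuit_le φ x₀ i).1
  · rw [(count_stageCircuit_le φ x₀ i).2]
    simp [GibbsQuery.isEnergy, GibbsQuery.isSample]

theorem IsChebyshevSchedule.coolingAlgorithm_prob [Nonempty Ω] {β : Fin (l + 1) → ℝ≥0∞}
    {B ε : ℝ} (hB : 1 ≤ B) (hε : 0 < ε) (hε1 : ε ≤ 1) {H : Ω → Fin (n + 1)}
    (hβ : IsChebyshevSchedule H β B) {φ : InteriorIndex l → S → Ω} {s₀ : S}
    {U : InteriorIndex l → Matrix.unitaryGroup S ℂ}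
    (hU : ∀ i, IsExactSampler s₀ (φ i) (U i) (gibbsDistribution H (β i))) (x₀ : Ω) {N K q : ℕ}
    (hN : 1 ≤ N) (hq : 1 ≤ q)
    (herr : l * (144 * Real.sqrt ((K + 1) * B) / q + 216 * 2 ^ K / q ^ 2 + 2 * B / 2 ^ K
      + 4 * ε * B / N) ≤ ε / 8) :
    3 / 4 ≤ (coolingAlgorithm β φ s₀ x₀ n N K q).prob H U
      {z | (1 - ε) * partitionFunction H ⊤ ≤ z ∧ z ≤ (1 + ε) * partitionFunction H ⊤} := by
  set E : Set ℝ := {z | (1 - ε) * partitionFunction H ⊤ ≤ z ∧ z ≤ (1 + ε) * partitionFunction H ⊤}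
  set δ := 144 * Real.sqrt ((K + 1) * B) / q + 216 * 2 ^ K / q ^ 2 + 2 * B / 2 ^ K
      + 4 * ε * B / N
  have hZ : ∀ i, 0 < partitionFunction H (β i) := by
    intro i
    by_cases h : β i = ⊤
    · rw [h]; exact hβ.ground_pos
    · exact partitionFunction_pos h
  set μ : Fin l → ℝ := fun i =>
    partitionFunction H (β i.succ) / partitionFunction H (β i.castSucc) with hμdef
  have hμ : ∀ i, 0 < μ i := fun i => div_pos (hZ _) (hZ _)
  have hlt : ∀ i : Fin l, β i.castSucc < β i.succ := fun i => hβ.strictMono Fin.castSucc_lt_succ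
  have hprod : Fintype.card Ω * ∏ i, μ i = partitionFunction H ⊤ := by
    have := prod_succ_div_castSucc (fun i => partitionFunction H (β i)) fun i => (hZ i).ne'
    simp only [hμdef]
    rw [this, hβ.last, hβ.zero, partitionFunction_zero]
    field_simp
  have hsq : ∀ i : Fin l, ∑ x, gibbsDistribution H (β i.castSucc) x *
      boltzmannRatio (β i.castSucc) (β i.succ) (H x) ^ 2 ≤ B * μ i ^ 2 := by
    intro i
    rw [sum_gibbs_mul_ratio_sq (hlt i)]
    have h := hβ.ratio_le i
    have h0 := hZ i.castSucc
    rw [div_le_iff₀ (pow_pos (hZ i.succ) 2)] at h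
    simp only [hμdef]
    rw [div_pow, ← mul_div_assoc, div_le_div_iff₀ h0 (pow_pos h0 2), sq (partitionFunction H
      (β i.castSucc)), ← mul_assoc]
    exact mul_le_mul_of_nonneg_right h h0.le
  choose ν hνr hν using fun i => meanRoutine_realizes (stageCircuit_prepares hβ.zero hU x₀ i)
    (f := fun j => boltzmannRatio (β i.castSucc) (β i.succ) j)
    (fun j => boltzmannRatio_nonneg _ _ _) (hμ i) hB hε.le
    (sum_gibbs_mul_ratio (hlt i).ne_top _) (hsq i) (N := N) (K := K) hN hq
  have hrun := Routine.Realizes.pi hνr E fun v => .output (Fintype.card Ω * ∏ i, v i)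
  refine le_of_le_of_eq ?_ hrun.symm
  -- Markov's inequality before averaging: the left side is at most the indicator of success.
  have hpoint : ∀ v : Fin l → ℝ, 1 - 2 / ε * ∑ i, min |v i / μ i - 1| ε
      ≤ QuantumProgram.prob (gibbsOracle H U) E (.output (Fintype.card Ω * ∏ i, v i))
        (Pi.single (initialMemory s₀ x₀ n (ZMod (4 * q + 1))) 1) := by
    intro v
    have hs : 0 ≤ ∑ i, min |v i / μ i - 1| ε :=
      Finset.sum_nonneg fun i _ => le_min (abs_nonneg _) hε.le
    have hout : QuantumProgram.prob (gibbsOracle H U) E (.output (Fintype.card Ω * ∏ i, v i))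
        (Pi.single (initialMemory s₀ x₀ n (ZMod (4 * q + 1))) 1)
          = if Fintype.card Ω * ∏ i, v i ∈ E then 1 else 0 := by
      have := stateNormSq_single (initialMemory s₀ x₀ n (ZMod (4 * q + 1)))
      rw [stateNormSq] at this
      rw [QuantumProgram.prob, this]
      congr
    rw [hout]
    by_cases hsmall : ∑ i, min |v i / μ i - 1| ε < ε / 2
    -- A sum below `ε/2` has no term equal to `ε`, so no cap is active.
    · have hcap : ∀ i, min |v i / μ i - 1| ε = |v i / μ i - 1| := by
        intro i
        have h1 : min |v i / μ i - 1| ε ≤ ∑ i, min |v i / μ i - 1| ε :=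
          Finset.single_le_sum (f := fun i => min |v i / μ i - 1| ε)
            (fun j _ => le_min (abs_nonneg _) hε.le) (Finset.mem_univ i)
        rcases min_choice |v i / μ i - 1| ε with h | h
        · exact h
        · rw [h] at h1; linarith
      have h2 := abs_prod_sub_le hμ hε1
        (by simpa only [hcap] using hsmall.le : ∑ i, |v i / μ i - 1| ≤ ε / 2)
      have h3 : Fintype.card Ω * ∏ i, v i ∈ E := by
        have hc : (0 : ℝ) ≤ Fintype.card Ω := Nat.cast_nonneg _
        rw [abs_le] at h2
        have h4 := mul_le_mul_of_nonneg_left h2.1 hc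
        have h5 := mul_le_mul_of_nonneg_left h2.2 hc
        constructor <;> rw [← hprod] <;> linarith
      rw [if_pos h3]
      have : 0 ≤ 2 / ε * ∑ i, min |v i / μ i - 1| ε := by positivity
      linarith
    · have h1 : 1 ≤ 2 / ε * ∑ i, min |v i / μ i - 1| ε := by
        calc (1 : ℝ) = 2 / ε * (ε / 2) := by field_simp
          _ ≤ _ := mul_le_mul_of_nonneg_left (not_lt.1 hsmall) (by positivity)
      split_ifs <;> linarith
  refine le_trans ?_ ((Expectation.pi ν).mono hpoint)
  rw [Expectation.sub, Expectation.const, Expectation.const_mul, Expectation.sum]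
  have hsum : ∑ i, (Expectation.pi ν fun v => min |v i / μ i - 1| ε) ≤ ε / 8 := by
    refine le_trans (Finset.sum_le_sum fun i _ => ?_)
      ((by simp : ∑ _i : Fin l, δ = l * δ).trans_le herr)
    rw [Expectation.pi_eval ν i fun v => min |v / μ i - 1| ε]
    exact hν i
  have := mul_le_mul_of_nonneg_left hsum (by positivity : 0 ≤ 2 / ε)
  have h8 : 2 / ε * (ε / 8) = 1 / 4 := by field_simp; norm_num
  linarith

end Algorithm

/-! ### The choice of the parameters -/

section Parameters

theorem one_le_logO (x : ℝ) : 1 ≤ logO x := le_max_left _ _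

/-- The factors `logO l` and `logO (logO _)` are at least `1` and are not needed, because the errors
are controlled in expectation. -/
theorem le_chebyshevSampleBound {B ε : ℝ} (hB : 1 ≤ B) (hε : 0 < ε) (l : ℕ) :
    l * (B * l / ε) * (logO (B * l / ε) * Real.sqrt (logO (B * l / ε)))
      ≤ chebyshevSampleBound B l ε := by
  have h1 := one_le_logO l
  have h2 := one_le_logO (B * l / ε)
  have h3 := one_le_logO (logO (B * l / ε))
  have hpow : logO (B * l / ε) ^ (3 / 2 : ℝ)
      = logO (B * l / ε) * Real.sqrt (logO (B * l / ε)) := by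
    rw [Real.sqrt_eq_rpow, show (3 / 2 : ℝ) = 1 + 1 / 2 by norm_num,
      Real.rpow_add (by linarith), Real.rpow_one]
  rw [chebyshevSampleBound, hpow]
  set Λ := logO (B * l / ε) * Real.sqrt (logO (B * l / ε))
  have hΛ : 0 ≤ Λ := by positivity
  have hB0 : 0 ≤ B := by linarith
  calc l * (B * l / ε) * Λ = B * (l : ℝ) ^ 2 * 1 / ε * Λ * 1 := by ring
    _ ≤ B * (l : ℝ) ^ 2 * logO l / ε * Λ * logO (logO (B * l / ε)) := by gcongr

theorem chebyshevSampleBound_nonneg {B ε : ℝ} (hB : 1 ≤ B) (hε : 0 < ε) (l : ℕ) :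
    0 ≤ chebyshevSampleBound B l ε :=
  le_trans (by have := one_le_logO (B * l / ε); positivity) (le_chebyshevSampleBound hB hε l)

theorem exists_levels {D : ℝ} (hD : 1 ≤ D) :
    ∃ K : ℕ, 64 * D ≤ 2 ^ K ∧ 2 ^ K ≤ 130 * D ∧ (K : ℝ) + 1 ≤ 11 * logO D := by
  have hceil : 1 < ⌈64 * D⌉₊ := by
    rw [Nat.lt_ceil]; push_cast; linarith
  have h1 : 64 * D ≤ 2 ^ Nat.clog 2 ⌈64 * D⌉₊ := by
    refine (Nat.le_ceil _).trans ?_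
    exact_mod_cast Nat.le_pow_clog (by norm_num) _
  -- Minimality of the exponent gives `2^K ≤ 2⌈64 D⌉ ≤ 2(64 D + 1) ≤ 130 D`.
  have h2 : (2 : ℝ) ^ Nat.clog 2 ⌈64 * D⌉₊ ≤ 130 * D := by
    have h3 := Nat.pow_pred_clog_lt_self (b := 2) (by norm_num) hceil
    have h4 : 0 < Nat.clog 2 ⌈64 * D⌉₊ := Nat.clog_pos (by norm_num) hceil
    obtain ⟨k, hk⟩ : ∃ k, Nat.clog 2 ⌈64 * D⌉₊ = k + 1 := ⟨_, (Nat.succ_pred h4.ne').symm⟩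
    rw [hk, Nat.pred_succ] at h3
    have h5 : (2 : ℝ) ^ k ≤ ⌈64 * D⌉₊ := by exact_mod_cast h3.le
    have h6 := Nat.ceil_lt_add_one (by linarith : 0 ≤ 64 * D)
    rw [hk, pow_succ]
    linarith
  refine ⟨_, h1, h2, ?_⟩
  set K := Nat.clog 2 ⌈64 * D⌉₊
  have hlog : (K : ℝ) * Real.log 2 ≤ Real.log 130 + Real.log D := by
    rw [← Real.log_pow, ← Real.log_mul (by norm_num) (by linarith)]
    exact Real.log_le_log (by positivity) h2
  have h130 : Real.log 130 ≤ 8 * Real.log 2 := by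
    rw [← Real.log_rpow (by norm_num)]
    exact Real.log_le_log (by norm_num) (by norm_num)
  have hl2 := Real.log_two_gt_d9
  have hl2' := Real.log_two_lt_d9
  have h7 : Real.log D ≤ logO D := le_max_right _ _
  have h8 := one_le_logO D
  -- Otherwise `K - 8 ≥ 2 logO D`, while `130 ≤ 2^8` gives `(K - 8) log 2 ≤ log D`; this contradicts
  -- `2 log 2 > 1`.
  by_contra hcon
  have h9 : 2 * logO D ≤ K - 8 := by linarith [not_le.1 hcon]
  nlinarith [mul_le_mul_of_nonneg_right h9 (by linarith : 0 ≤ Real.log 2)]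

end Parameters

end

/-! ### The main theorem: parameters, cost and total error. -/

theorem mainTheorem7 :
    ∃ C : ℝ, 0 < C ∧
      ∀ (Ω : Type) [Fintype Ω] [DecidableEq Ω] [Nonempty Ω] (n l : ℕ)
        (β : Fin (l + 1) → ℝ≥0∞) (B ε : ℝ), 1 ≤ B → 0 < ε →
      ∀ (S : Type) [Fintype S] [DecidableEq S] (s₀ : S) (φ : InteriorIndex l → S → Ω),
        ∃ alg : GibbsAlgorithm S Ω n (InteriorIndex l),
          (alg.sampleCount : ℝ) ≤ C * chebyshevSampleBound B l ε ∧
          (alg.energyCount : ℝ) ≤ C * chebyshevSampleBound B l ε ∧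
          ∀ (H : Ω → Fin (n + 1)) (U : InteriorIndex l → Matrix.unitaryGroup S ℂ),
            IsChebyshevSchedule H β B →
            (∀ i, IsExactSampler s₀ (φ i) (U i) (gibbsDistribution H (β i))) →
            3 / 4 ≤ alg.prob H U
              {z | (1 - ε) * partitionFunction H ⊤ ≤ z ∧ z ≤ (1 + ε) * partitionFunction H ⊤} := by
  refine ⟨5000000, by norm_num, ?_⟩
  intro Ω _ _ _ n l β B ε hB hε S _ _ s₀ φ
  let x₀ : Ω := Classical.arbitrary Ω
  have hbound := chebyshevSampleBound_nonneg hB hε l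
  -- For `l = 0` there is no schedule, as `0 ≠ ∞`; for `ε > 1` the output `0` is accurate enough.
  by_cases htriv : l = 0 ∨ 1 < ε
  · refine ⟨{ W := Unit, start := (s₀, x₀, 0, ()), program := .output 0 }, ?_, ?_, ?_⟩
    · have : (0 : ℝ) ≤ 5000000 * chebyshevSampleBound B l ε := by positivity
      simpa [GibbsAlgorithm.sampleCount, QuantumProgram.queryCount] using this
    · have : (0 : ℝ) ≤ 5000000 * chebyshevSampleBound B l ε := by positivity
      simpa [GibbsAlgorithm.energyCount, QuantumProgram.queryCount] using this
    · intro H U hβ _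
      rcases htriv with rfl | hε1
      · have h1 := hβ.zero
        have h2 := hβ.last
        rw [Fin.last_zero, h1] at h2
        exact absurd h2 (by simp)
      · have hg := hβ.ground_pos
        have hmem : (0 : ℝ) ∈ {z | (1 - ε) * partitionFunction H ⊤ ≤ z ∧
            z ≤ (1 + ε) * partitionFunction H ⊤} := by
          constructor
          · exact mul_nonpos_of_nonpos_of_nonneg (by linarith) hg.le
          · positivity
        have := stateNormSq_single ((s₀, x₀, 0, ()) : GibbsMemory S Ω n Unit)
        rw [stateNormSq] at this
        simp only [GibbsAlgorithm.prob, QuantumProgram.prob]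
        rw [if_pos hmem]
        refine le_of_le_of_eq (by norm_num) this.symm
  · push Not at htriv
    obtain ⟨hl, hε1⟩ := htriv
    have hl1 : (1 : ℝ) ≤ l := by exact_mod_cast Nat.one_le_iff_ne_zero.2 hl
    set D := B * l / ε with hD
    have hBl : 1 ≤ B * l := one_le_mul_of_one_le_of_one_le hB hl1
    have hDBl : B * l ≤ D := by
      rw [hD, le_div_iff₀ hε]; nlinarith
    have hD1 : 1 ≤ D := hBl.trans hDBl
    obtain ⟨K, hK1, hK2, hK3⟩ := exists_levels hD1
    set Λ := logO D
    have hΛ : 1 ≤ Λ := one_le_logO D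
    have hsΛ : 1 ≤ Real.sqrt Λ := Real.one_le_sqrt.2 hΛ
    set s := Real.sqrt (K + 1)
    have hs1 : 1 ≤ s := Real.one_le_sqrt.2 (by linarith [(Nat.cast_nonneg K : (0 : ℝ) ≤ K)])
    have hs2 : s ≤ 4 * Real.sqrt Λ := by
      have : (4 : ℝ) * Real.sqrt Λ = Real.sqrt (16 * Λ) := by
        rw [Real.sqrt_mul (by norm_num), show (16 : ℝ) = 4 ^ 2 by norm_num,
          Real.sqrt_sq (by norm_num)]
      rw [this]
      exact Real.sqrt_le_sqrt (by linarith)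
    -- `N` bounds the cost of wrong scales by `ε/16`. The factor `s = √(K+1)` in `q` cancels the
    -- loss from Cauchy–Schwarz.
    set N := ⌈64 * (B * l)⌉₊
    set q := ⌈10000 * (s * D)⌉₊
    have hsD : 1 ≤ s * D := one_le_mul_of_one_le_of_one_le hs1 hD1
    have hN1 : 64 * (B * l) ≤ N := Nat.le_ceil _
    have hN2 : (N : ℝ) ≤ 65 * D := by
      have := Nat.ceil_lt_add_one (by linarith : 0 ≤ 64 * (B * l))
      linarith
    have hq1 : 10000 * (s * D) ≤ q := Nat.le_ceil _
    have hq2 : (q : ℝ) ≤ 10001 * (s * D) := by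
      have := Nat.ceil_lt_add_one (by linarith : 0 ≤ 10000 * (s * D))
      linarith
    have hNpos : 1 ≤ N := by
      have : (1 : ℝ) ≤ N := by linarith
      exact_mod_cast this
    have hqpos : 1 ≤ q := by
      have : (1 : ℝ) ≤ q := by linarith
      exact_mod_cast this
    have hcount : ((l * (N + (K + 1) * (8 * q + 3)) : ℕ) : ℝ)
        ≤ 5000000 * chebyshevSampleBound B l ε := by
      refine le_trans ?_ (mul_le_mul_of_nonneg_left (le_chebyshevSampleBound hB hε l)
        (by norm_num))
      have hΛs : 1 ≤ Λ * Real.sqrt Λ := one_le_mul_of_one_le_of_one_le hΛ hsΛ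
      have h1 : (N : ℝ) ≤ 65 * (D * (Λ * Real.sqrt Λ)) := by
        have := mul_le_mul_of_nonneg_left hΛs (by linarith : 0 ≤ D)
        linarith
      -- The exponent `3/2`: at most `11 Λ` levels, each costing a multiple of `√Λ · D`.
      have h2 : ((K : ℝ) + 1) * (8 * q + 3) ≤ 4500000 * (D * (Λ * Real.sqrt Λ)) := by
        have h3 : 8 * (q : ℝ) + 3 ≤ 320400 * (Real.sqrt Λ * D) := by
          have h4 : s * D ≤ 4 * Real.sqrt Λ * D := mul_le_mul_of_nonneg_right hs2 (by linarith)
          have h5 : 1 ≤ Real.sqrt Λ * D := one_le_mul_of_one_le_of_one_le hsΛ hD1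
          linarith
        calc ((K : ℝ) + 1) * (8 * q + 3) ≤ (11 * Λ) * (320400 * (Real.sqrt Λ * D)) :=
              mul_le_mul hK3 h3 (by positivity) (by linarith)
          _ = 3524400 * (D * (Λ * Real.sqrt Λ)) := by ring
          _ ≤ _ := mul_le_mul_of_nonneg_right (by norm_num) (by positivity)
      push_cast
      calc (l : ℝ) * (N + (K + 1) * (8 * q + 3))
          ≤ l * (65 * (D * (Λ * Real.sqrt Λ)) + 4500000 * (D * (Λ * Real.sqrt Λ))) := by gcongr
        _ = 4500065 * (l * D * (Λ * Real.sqrt Λ)) := by ring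
        _ ≤ _ := mul_le_mul_of_nonneg_right (by norm_num) (by positivity)
    obtain ⟨hc1, hc2⟩ := coolingAlgorithm_counts β φ s₀ x₀ n N K q
    refine ⟨coolingAlgorithm β φ s₀ x₀ n N K q, (Nat.cast_le.2 hc1).trans hcount,
      (Nat.cast_le.2 hc2).trans hcount, fun H U hβ hU =>
        hβ.coolingAlgorithm_prob hB hε hε1 hU x₀ hNpos hqpos ?_⟩
    have hl0 : (0 : ℝ) < l := by linarith
    have hB0 : 0 < B := by linarith
    have hq0 : (0 : ℝ) < q := by exact_mod_cast hqpos
    have hN0 : (0 : ℝ) < N := by exact_mod_cast hNpos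
    have hDl : D * ε = B * l := by rw [hD]; field_simp
    have e1 : l * (144 * Real.sqrt ((K + 1) * B) / q) ≤ 0.0144 * ε := by
      -- The bound is linear in `B`, so the square root from Cauchy–Schwarz may be given away.
      have hsB : Real.sqrt B ≤ B := Real.sqrt_le_self_iff.2 (Or.inr hB)
      have hr : Real.sqrt ((K + 1) * B) = s * Real.sqrt B := Real.sqrt_mul (by positivity) _
      rw [hr, ← mul_div_assoc, div_le_iff₀ hq0]
      calc l * (144 * (s * Real.sqrt B)) ≤ l * (144 * (s * B)) := by gcongr
        _ = 0.0144 * ε * (10000 * (s * D)) := by linear_combination (-144 * s) * hDl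
        _ ≤ _ := by gcongr
    have e2 : l * (216 * 2 ^ K / q ^ 2) ≤ 0.001 * ε := by
      have hqD : 10000 * D ≤ q := by
        have := mul_le_mul_of_nonneg_right hs1 (by linarith : 0 ≤ D)
        linarith
      rw [← mul_div_assoc, div_le_iff₀ (by positivity)]
      have hlB : (l : ℝ) ≤ D * ε := by rw [hDl]; nlinarith
      calc l * (216 * 2 ^ K) ≤ (D * ε) * (216 * (130 * D)) := by gcongr
        _ ≤ 0.001 * ε * (10000 * D) ^ 2 := by
          have : 0 ≤ D ^ 2 * ε := by positivity
          nlinarith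
        _ ≤ _ := by gcongr
    have e3 : l * (2 * B / 2 ^ K) ≤ ε / 32 := by
      rw [← mul_div_assoc, div_le_iff₀ (by positivity)]
      calc l * (2 * B) = ε / 32 * (64 * D) := by linear_combination (-2) * hDl
        _ ≤ _ := by gcongr
    have e4 : l * (4 * ε * B / N) ≤ ε / 16 := by
      rw [← mul_div_assoc, div_le_iff₀ hN0]
      calc l * (4 * ε * B) = ε / 16 * (64 * (B * l)) := by ring
        _ ≤ _ := by gcongr
    -- `0.0144 + 0.001 + 1/32 + 1/16 < 1/8`.
    rw [mul_add, mul_add, mul_add]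
    linarith
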